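/- **Soundness of $\mathrm{VFM}^\infty$.** Let $\mathcal L_{\mathbb N}$ be a language of arithmetic with the function symbols $0,S,+,\cdot$, symbols for the syntactic operations on Gödel numbers and finitely many further symbols for primitive recursive functions, and let $\mathcal L_{\mathrm{Tr}}=\mathcal L_{\mathbb N}\cup\{\mathrm{Tr}\}$, with logical symbols $\neg,\wedge,\vee,\forall,\exists$ ($A\to B$ is $\neg A\vee B$). The symbols $\dot\neg,\dot\to,\dot\forall,\dot=$ form Gödel numbers of formulas, and $n(i/m)$ is a closed term for the Gödel number of the result of substituting the numeral of $i$ for the variable with Gödel number $m$ in the formula with Gödel number $n$ (its value is not the Gödel number of a formula if $n,m$ are not of this form). PAT is first-order logic with equality and PA with induction for all $\mathcal L_{\mathrm{Tr}}$-formulas and true arithmetical defining axioms for the function symbols; its axioms are universally closed. Fix any arithmetical formulas $\mathrm{CT}(x)$, $\mathrm{Sent}(x)$, $\mathrm{Ax}_{\mathrm{PAT}}(x)$ and $x^\circ=y^\circ$ that define in $\mathbb N$ the sets of Gödel numbers of closed terms, of $\mathcal L_{\mathrm{Tr}}$-sentences and of axioms of PAT, and, between Gödel numbers of closed terms, the relation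 of having equal values. A sequent is a finite set of $\mathcal L_{\mathrm{Tr}}$-sentences, each identified with its negation normal form; $\varGamma,A$ means $\varGamma\cup\{A\}$. It is $\mathrm{Tr}$-positive if no $\neg\mathrm{Tr}(t)$ occurs in its (negation normal) members. Numbers stand for their numerals; $t,s$ are closed terms; $t\simeq s$ says that $t$ is any closed term with the value of $s$; $\mathrm{co}(A)$ is the logical complexity (literals have complexity $0$). *The calculus $\mathrm{VFM}^\infty$.* $\vdash^{\alpha}_{k}\varGamma$ (length $\alpha$, an ordinal; cut rank $k\in\mathbb N$) is inductively defined as follows, where all lengths $\alpha_i$ of premises satisfy $\alpha_i<\alpha$. Axioms: $\vdash^\alpha_k\varGamma,A$ for a true arithmetical literal $A$; $\vdash^\alpha_k\varGamma,\neg\mathrm{Tr}(s),\mathrm{Tr}(t\simeq s)$; and, for $n\in\mathbb N$, $\vdash^\alpha_k\varGamma,\mathrm{Tr}(t)$ if the value of $t$ is the Gödel number of $\neg(\mathrm{Tr}(n)\wedge\mathrm{Tr}(\dot\neg n))$, of $\mathrm{Sent}(n)\to(\mathrm{Tr}(n)\vee\mathrm{Tr}(\dot\neg n))$, or of $\mathrm{Tr}(n)\to\mathrm{Sent}(n)$.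 Rules: the usual rules for $\vee,\wedge,\exists$, the $\omega$-rule for $\forall$ (premises $\varGamma,A(i)$ of lengths $\alpha_i$, $i\in\mathbb N$), cut on formulas with $\mathrm{co}(A)<k$, and $(\mathrm{Tr}_=)$ from $\varGamma,\mathrm{CT}(n)\wedge\mathrm{CT}(m)\wedge n^\circ=m^\circ$ infer $\varGamma,\mathrm{Tr}(t\simeq n\,\dot=\,m)$; $(\mathrm{Tr}_{\ne})$ from $\varGamma,\mathrm{CT}(n)\wedge\mathrm{CT}(m)\wedge\mathrm{Tr}(n\,\dot=\,m)\wedge n^\circ\ne m^\circ$ infer $\varGamma$; $(\mathrm{Tr}_\to)$ from $\varGamma,\mathrm{Tr}(n)$ and $\varGamma,\mathrm{Tr}(n\,\dot\to\, m)$ infer $\varGamma,\mathrm{Tr}(t\simeq m)$; $(\mathrm{Tr}_\forall)$ from $\varGamma,\mathrm{Tr}(n(i/m))$ with lengths $\alpha_i$, for all $i\in\mathbb N$, infer $\varGamma,\mathrm{Tr}(t\simeq\dot\forall mn)$; $(\mathrm{Rep})$ from $\varGamma,\mathrm{Tr}(n)$ infer $\varGamma,\mathrm{Tr}(t\simeq\ulcorner\mathrm{Tr}(n)\urcorner)$;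 $(\mathrm{Del})$ from $\varGamma,\mathrm{Tr}\ulcorner\mathrm{Tr}(\dot n)\urcorner$ infer $\varGamma,\mathrm{Tr}(t\simeq n)$; $(\mathrm{Tr}_{\mathrm{PAT}})$ from $\varGamma,\mathrm{Ax}_{\mathrm{PAT}}(n)$ infer $\varGamma,\mathrm{Tr}(t\simeq n)$; $(\mathrm{Cons})$ from $\varGamma,\mathrm{Tr}(n)$ and $\varGamma,\mathrm{Tr}(\dot\neg n)$ infer $\varGamma$. *The relation $I$.* $I(i;\alpha;\beta;\varGamma)$, for $i\in\{0,1\}$ and ordinals $\alpha,\beta$, is the least relation closed under the following clauses, with $\alpha_0<\alpha$ and $\beta_0,\beta_n<\beta$. It holds if $\varGamma$ contains a true literal $s=t$ or $s\ne t$; or both $\mathrm{Tr}(s)$ and $\neg\mathrm{Tr}(t)$ with $s,t$ of equal value; or (Comp) both $\mathrm{Tr}(s)$ and $\mathrm{Tr}(t)$, where the values of $s,t$ are the Gödel numbers of $A$ and of $\neg A$ for some $\mathcal L_{\mathrm{Tr}}$-sentence $A$. If $I(i;\alpha;\beta_0;\varGamma,A_0,A_1)$ then $I(i;\alpha;\beta;\varGamma,A_0\vee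 A_1)$. If $I(i;\alpha;\beta_0;\varGamma,A_0)$ and $I(i;\alpha;\beta_0;\varGamma,A_1)$ then $I(i;\alpha;\beta;\varGamma,A_0\wedge A_1)$. If $I(i;\alpha;\beta_0;\varGamma,A(n))$ for some $n$ then $I(i;\alpha;\beta;\varGamma,\exists xA(x))$. If $I(i;\alpha;\beta_n;\varGamma,A(n))$ for all $n\in\mathbb N$ then $I(i;\alpha;\beta;\varGamma,\forall xA(x))$. If $I(i;\alpha_0;\beta_0;A)$ then $I(i;\alpha;\beta;\varGamma,\mathrm{Tr}(t\simeq\ulcorner A\urcorner))$. (Cons) If $I(i;\alpha;\beta_0;\varGamma,\mathrm{Tr}(n))$ and $I(i;\alpha;\beta_0;\varGamma,\mathrm{Tr}(\dot\neg n))$ then $I(1;\alpha;\beta;\varGamma)$. (Norm) If $I(i;\alpha;\beta_0;\varGamma,\mathrm{Tr}(n))$ and $n$ is not the Gödel number of an $\mathcal L_{\mathrm{Tr}}$-sentence then $I(1;\alpha;\beta;\varGamma)$. *Satisfaction at level $\alpha$.* For $\mathrm{Tr}$-positive sentences, $\models^\alpha A$ is defined inductively: true literals $s=t$, $s\neq t$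 are satisfied and false ones are not; $\models^\alpha\mathrm{Tr}(t)$ iff the value of $t$ is the Gödel number of an $\mathcal L_{\mathrm{Tr}}$-sentence $A$ with $I(1;\alpha;\varepsilon_\alpha;A)$, where $\varepsilon_\alpha$ is the $\alpha$-th epsilon number; $\wedge,\vee,\forall,\exists$ are treated as usual, quantifiers ranging over numerals. For a $\mathrm{Tr}$-positive sequent, $\models^\alpha\varGamma$ means that $\models^\alpha A$ for some $A\in\varGamma$. **Theorem.** Let $\varGamma$ be any $\mathrm{Tr}$-positive sequent and $\alpha$ an ordinal. If $\mathrm{VFM}^\infty\vdash^{\alpha}_{0}\varGamma$, then $\models^\alpha\varGamma$. -/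

import Mathlib

/-!
Infinitary truth-theoretic calculi over the language of arithmetic with a truth predicate.

The arithmetical language has function symbols for zero, successor, addition, multiplication, for
the syntactic operations on Gödel numbers, and for finitely many further primitive recursive
functions, which are a parameter.
-/

namespace VFM

open scoped Ordinal

/-- The further primitive recursive function symbols of the arithmetical language: finitely many
symbols with their arities and the primitive recursive functions they stand for. -/
structure Signature where
  size : ℕ
  arity : Fin size → ℕ
  fn : (i : Fin size) → (Fin (arity i) → ℕ) → ℕ
  primrec : ∀ i, Nat.Primrec' (fun v : List.Vector ℕ (arity i) => fn i v.get)

/-- Function symbols. The symbols whose name starts with `dot` stand for the syntactic operations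
on Gödel numbers; `numeral` stands for the map from `n` to the Gödel number of the `n`-th numeral,
and `dotSub` for substitution of a term for a variable in a formula. -/
inductive FSym (L : Signature) : Type
  | zero | succ | add | mul
  | numeral | dotSub
  | dotEq | dotTr | dotNeg | dotAnd | dotOr | dotAll | dotEx
  | extra (i : Fin L.size)

def FSym.arity {L : Signature} : FSym L → ℕ
  | zero => 0
  | succ => 1
  | add => 2
  | mul => 2
  | numeral => 1
  | dotSub => 3
  | dotEq => 2
  | dotTr => 1
  | dotNeg => 1
  | dotAnd => 2
  | dotOr => 2
  | dotAll => 2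
  | dotEx => 2
  | extra i => L.arity i

inductive Term (L : Signature) : Type
  | var (v : ℕ)
  | app (f : FSym L) (ts : Fin f.arity → Term L)

/-- Formulas of the language with the truth predicate `tr`; variables are natural numbers. -/
inductive Form (L : Signature) : Type
  | eq (s t : Term L)
  | tr (t : Term L)
  | neg (A : Form L)
  | and (A B : Form L)
  | or (A B : Form L)
  | all (v : ℕ) (A : Form L)
  | ex (v : ℕ) (A : Form L)

noncomputable instance (L : Signature) : DecidableEq (Form L) := Classical.decEq _

variable {L : Signature}

/-! ### Syntax -/

namespace Term

def vars : Term L → Set ℕ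
  | var v => {v}
  | app _ ts => ⋃ i, vars (ts i)

def Closed (t : Term L) : Prop := t.vars = ∅

/-- `r.subst x t` is the result of substituting the term `t` for the variable `x` in `r`. -/
def subst : Term L → ℕ → Term L → Term L
  | var v, x, t => if v = x then t else var v
  | app f ts, x, t => app f (fun i => subst (ts i) x t)

def zero : Term L := app .zero ![]

def succ (t : Term L) : Term L := app .succ ![t]

def add (s t : Term L) : Term L := app .add ![s, t]

def mul (s t : Term L) : Term L := app .mul ![s, t]

/-- The numeral of a natural number. -/
def num : ℕ → Term L
  | 0 => zero
  | n + 1 => succ (num n)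

end Term

namespace Form

open Term

/-- `A → B` abbreviates `¬ A ∨ B`. -/
def imp (A B : Form L) : Form L := or (neg A) B

/-- The set of free variables. -/
def fv : Form L → Set ℕ
  | eq s t => s.vars ∪ t.vars
  | tr t => t.vars
  | neg A => fv A
  | and A B => fv A ∪ fv B
  | or A B => fv A ∪ fv B
  | all v A => fv A \ {v}
  | ex v A => fv A \ {v}

def IsSentence (A : Form L) : Prop := A.fv = ∅

/-- `A.subst x t` is the result of substituting the term `t` for the free occurrences of the
variable `x` in `A`. -/
def subst : Form L → ℕ → Term L → Form L
  | eq r s, x, t => eq (r.subst x t) (s.subst x t)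
  | tr r, x, t => tr (r.subst x t)
  | neg A, x, t => neg (subst A x t)
  | and A B, x, t => and (subst A x t) (subst B x t)
  | or A B, x, t => or (subst A x t) (subst B x t)
  | all v A, x, t => if v = x then all v A else all v (subst A x t)
  | ex v A, x, t => if v = x then ex v A else ex v (subst A x t)

/-- The term `t` is free for the variable `x` in the formula. -/
def FreeFor (x : ℕ) (t : Term L) : Form L → Prop
  | eq _ _ => True
  | tr _ => True
  | neg A => FreeFor x t A
  | and A B => FreeFor x t A ∧ FreeFor x t B
  | or A B => FreeFor x t A ∧ FreeFor x t B
  | all v A => x ∉ fv (all v A) ∨ (v ∉ t.vars ∧ FreeFor x t A)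
  | ex v A => x ∉ fv (ex v A) ∨ (v ∉ t.vars ∧ FreeFor x t A)

/-- The negation normal form of the formula (`true`) or of its negation (`false`). -/
def nnfSigned : Form L → Bool → Form L
  | eq s t, true => eq s t
  | eq s t, false => neg (eq s t)
  | tr t, true => tr t
  | tr t, false => neg (tr t)
  | neg A, true => nnfSigned A false
  | neg A, false => nnfSigned A true
  | and A B, true => and (nnfSigned A true) (nnfSigned B true)
  | and A B, false => or (nnfSigned A false) (nnfSigned B false)
  | or A B, true => or (nnfSigned A true) (nnfSigned B true)
  | or A B, false => and (nnfSigned A false) (nnfSigned B false)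
  | all v A, true => all v (nnfSigned A true)
  | all v A, false => ex v (nnfSigned A false)
  | ex v A, true => ex v (nnfSigned A true)
  | ex v A, false => all v (nnfSigned A false)

/-- The negation normal form. -/
def nnf (A : Form L) : Form L := A.nnfSigned true

/-- The formula is in negation normal form: only atomic formulas are negated. -/
def IsNNF : Form L → Prop
  | eq _ _ => True
  | tr _ => True
  | neg (eq _ _) => True
  | neg (tr _) => True
  | neg _ => False
  | and A B => IsNNF A ∧ IsNNF B
  | or A B => IsNNF A ∧ IsNNF B
  | all _ A => IsNNF A
  | ex _ A => IsNNF A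

/-- A formula in negation normal form in which the truth predicate is not negated. -/
def TrPositive : Form L → Prop
  | eq _ _ => True
  | tr _ => True
  | neg (eq _ _) => True
  | neg _ => False
  | and A B => TrPositive A ∧ TrPositive B
  | or A B => TrPositive A ∧ TrPositive B
  | all _ A => TrPositive A
  | ex _ A => TrPositive A

/-- The formula does not contain the truth predicate. -/
def Arithmetical : Form L → Prop
  | eq _ _ => True
  | tr _ => False
  | neg A => Arithmetical A
  | and A B => Arithmetical A ∧ Arithmetical B
  | or A B => Arithmetical A ∧ Arithmetical B
  | all _ A => Arithmetical A
  | ex _ A => Arithmetical A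

/-- Logical complexity. -/
def co : Form L → ℕ
  | eq _ _ => 0
  | tr _ => 0
  | neg A => co A
  | and A B => max (co A) (co B) + 1
  | or A B => max (co A) (co B) + 1
  | all _ A => co A + 1
  | ex _ A => co A + 1

end Form

/-! ### Gödel numbers and the standard interpretation of the function symbols -/

def mkEq (a b : ℕ) : ℕ := Nat.pair 0 (Nat.pair a b) + 1
def mkTr (a : ℕ) : ℕ := Nat.pair 1 a + 1
def mkNeg (a : ℕ) : ℕ := Nat.pair 2 a + 1
def mkAnd (a b : ℕ) : ℕ := Nat.pair 3 (Nat.pair a b) + 1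
def mkOr (a b : ℕ) : ℕ := Nat.pair 4 (Nat.pair a b) + 1
def mkAll (v a : ℕ) : ℕ := Nat.pair 5 (Nat.pair v a) + 1
def mkEx (v a : ℕ) : ℕ := Nat.pair 6 (Nat.pair v a) + 1

def FSym.code : FSym L → ℕ
  | zero => 0
  | succ => 1
  | add => 2
  | mul => 3
  | numeral => 4
  | dotSub => 5
  | dotEq => 6
  | dotTr => 7
  | dotNeg => 8
  | dotAnd => 9
  | dotOr => 10
  | dotAll => 11
  | dotEx => 12
  | extra i => 13 + i

/-- The Gödel number of a term. -/
def Term.code : Term L → ℕ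
  | var v => Nat.pair 0 v
  | app f ts => Nat.pair 1 (Nat.pair f.code (Encodable.encode (List.ofFn fun i => code (ts i))))

/-- The Gödel number of a formula. -/
def Form.code : Form L → ℕ
  | eq s t => mkEq s.code t.code
  | tr t => mkTr t.code
  | neg A => mkNeg (code A)
  | and A B => mkAnd (code A) (code B)
  | or A B => mkOr (code A) (code B)
  | all v A => mkAll (Term.var v : Term L).code (code A)
  | ex v A => mkEx (Term.var v : Term L).code (code A)

theorem FSym.code_injective : Function.Injective (FSym.code (L := L)) := by
  intro f g h
  cases f <;> cases g <;> simp only [FSym.code] at h <;> first | rfl | omega | skip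
  congr 1
  exact Fin.ext (by omega)

theorem Term.code_injective : Function.Injective (Term.code (L := L)) := by
  intro s
  induction s with
  | var v =>
    intro t h
    cases t with
    | var w => simpa [Term.code] using h
    | app g us => simp [Term.code] at h
  | app f ts ih =>
    intro t h
    cases t with
    | var w => simp [Term.code] at h
    | app g us =>
      simp only [Term.code, Nat.pair_eq_pair, true_and] at h
      obtain ⟨hf, hl⟩ := h
      obtain rfl := FSym.code_injective hf
      have hl2 := List.ofFn_injective (Encodable.encode_injective hl)
      congr 1
      funext i
      exact ih i (congrFun hl2 i)

/-- Gödel numbering of formulas is injective. -/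
theorem Form.code_injective : Function.Injective (Form.code (L := L)) := by
  intro A
  induction A with
  | eq s t =>
    intro B h
    cases B <;> simp [Form.code, mkEq, mkTr, mkNeg, mkAnd, mkOr, mkAll, mkEx] at h
    rw [Term.code_injective h.1, Term.code_injective h.2]
  | tr t =>
    intro B h
    cases B <;> simp [Form.code, mkEq, mkTr, mkNeg, mkAnd, mkOr, mkAll, mkEx] at h
    rw [Term.code_injective h]
  | neg A ih =>
    intro B h
    cases B <;> simp [Form.code, mkEq, mkTr, mkNeg, mkAnd, mkOr, mkAll, mkEx] at h
    rw [ih h]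
  | and A B ihA ihB =>
    intro C h
    cases C <;> simp [Form.code, mkEq, mkTr, mkNeg, mkAnd, mkOr, mkAll, mkEx] at h
    rw [ihA h.1, ihB h.2]
  | or A B ihA ihB =>
    intro C h
    cases C <;> simp [Form.code, mkEq, mkTr, mkNeg, mkAnd, mkOr, mkAll, mkEx] at h
    rw [ihA h.1, ihB h.2]
  | all v A ih =>
    intro C h
    cases C <;> simp [Form.code, mkEq, mkTr, mkNeg, mkAnd, mkOr, mkAll, mkEx] at h
    rw [ih h.2, Term.var.inj (Term.code_injective h.1)]
  | ex v A ih =>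
    intro C h
    cases C <;> simp [Form.code, mkEq, mkTr, mkNeg, mkAnd, mkOr, mkAll, mkEx] at h
    rw [ih h.2, Term.var.inj (Term.code_injective h.1)]

open Classical in
/-- The Gödel number of `A(s/v)`, given those of the formula `A`, the term `s` and the variable `v`;
it is `0`, which is no Gödel number of a formula, on all other arguments. -/
noncomputable def subCode (L : Signature) (a s v : ℕ) : ℕ :=
  if h : ∃ p : Form L × Term L × ℕ,
      p.1.code = a ∧ p.2.1.code = s ∧ (Term.var p.2.2 : Term L).code = v
  then (h.choose.1.subst h.choose.2.2 h.choose.2.1).code else 0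

/-- The standard interpretation of the function symbols. -/
noncomputable def FSym.interp : (f : FSym L) → (Fin f.arity → ℕ) → ℕ
  | zero => fun _ => 0
  | succ => fun (a : Fin 1 → ℕ) => a 0 + 1
  | add => fun (a : Fin 2 → ℕ) => a 0 + a 1
  | mul => fun (a : Fin 2 → ℕ) => a 0 * a 1
  | numeral => fun (a : Fin 1 → ℕ) => (Term.num (a 0) : Term L).code
  | dotSub => fun (a : Fin 3 → ℕ) => subCode L (a 0) (a 1) (a 2)
  | dotEq => fun (a : Fin 2 → ℕ) => mkEq (a 0) (a 1)
  | dotTr => fun (a : Fin 1 → ℕ) => mkTr (a 0)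
  | dotNeg => fun (a : Fin 1 → ℕ) => mkNeg (a 0)
  | dotAnd => fun (a : Fin 2 → ℕ) => mkAnd (a 0) (a 1)
  | dotOr => fun (a : Fin 2 → ℕ) => mkOr (a 0) (a 1)
  | dotAll => fun (a : Fin 2 → ℕ) => mkAll (a 0) (a 1)
  | dotEx => fun (a : Fin 2 → ℕ) => mkEx (a 0) (a 1)
  | extra i => L.fn i

/-- The value of a term in the standard model under an assignment. -/
noncomputable def Term.val (e : ℕ → ℕ) : Term L → ℕ
  | var v => e v
  | app f ts => f.interp (fun i => val e (ts i))

/-- The value of a closed term. -/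
noncomputable def Term.value (t : Term L) : ℕ := t.val (fun _ => 0)

/-- Satisfaction in the standard model of arithmetic, with the truth predicate interpreted
by the set `X`. -/
def Form.Sat (X : Set ℕ) : (ℕ → ℕ) → Form L → Prop
  | e, eq s t => s.val e = t.val e
  | e, tr t => t.val e ∈ X
  | e, neg A => ¬ Sat X e A
  | e, and A B => Sat X e A ∧ Sat X e B
  | e, or A B => Sat X e A ∨ Sat X e B
  | e, all v A => ∀ n, Sat X (Function.update e v n) A
  | e, ex v A => ∃ n, Sat X (Function.update e v n) A

/-- Truth of an arithmetical sentence in the standard model (the interpretation of the truth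
predicate and the assignment are then irrelevant). -/
def Form.Holds (A : Form L) : Prop := A.Sat ∅ (fun _ => 0)

/-- Gödel numbers of closed terms. -/
def closedTermCodes (L : Signature) : Set ℕ := {n | ∃ t : Term L, t.Closed ∧ t.code = n}

/-- Gödel numbers of sentences of the language with the truth predicate. -/
def sentenceCodes (L : Signature) : Set ℕ := {n | ∃ A : Form L, A.IsSentence ∧ A.code = n}

/-! ### Peano arithmetic with induction for the language with the truth predicate -/

section PAT

open Term Form

/-- Axioms of classical first-order logic with equality (modus ponens being the only rule for
sentences) and of Peano arithmetic with induction for all formulas, before universal closure. The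
set `D` holds the defining axioms of the function symbols other than zero, successor, addition and
multiplication. -/
inductive BasicAxiom (D : Set (Form L)) : Form L → Prop
  | imp_intro (A B : Form L) : BasicAxiom D (A.imp (B.imp A))
  | imp_distrib (A B C : Form L) :
      BasicAxiom D ((A.imp (B.imp C)).imp ((A.imp B).imp (A.imp C)))
  | and_left (A B : Form L) : BasicAxiom D ((A.and B).imp A)
  | and_right (A B : Form L) : BasicAxiom D ((A.and B).imp B)
  | and_intro (A B : Form L) : BasicAxiom D (A.imp (B.imp (A.and B)))
  | or_left (A B : Form L) : BasicAxiom D (A.imp (A.or B))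
  | or_right (A B : Form L) : BasicAxiom D (B.imp (A.or B))
  | or_elim (A B C : Form L) :
      BasicAxiom D ((A.imp C).imp ((B.imp C).imp ((A.or B).imp C)))
  | neg_intro (A B : Form L) : BasicAxiom D ((A.imp B).imp ((A.imp B.neg).imp A.neg))
  | neg_elim (A : Form L) : BasicAxiom D (A.neg.neg.imp A)
  | all_elim (x : ℕ) (t : Term L) (A : Form L) (h : A.FreeFor x t) :
      BasicAxiom D ((all x A).imp (A.subst x t))
  | all_distrib (x : ℕ) (A B : Form L) :
      BasicAxiom D ((all x (A.imp B)).imp ((all x A).imp (all x B)))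
  | all_intro (x : ℕ) (A : Form L) (h : x ∉ A.fv) : BasicAxiom D (A.imp (all x A))
  | ex_intro (x : ℕ) (t : Term L) (A : Form L) (h : A.FreeFor x t) :
      BasicAxiom D ((A.subst x t).imp (ex x A))
  | ex_elim (x : ℕ) (A B : Form L) (h : x ∉ B.fv) :
      BasicAxiom D ((all x (A.imp B)).imp ((ex x A).imp B))
  | eq_refl (t : Term L) : BasicAxiom D (eq t t)
  | eq_subst (x : ℕ) (s t : Term L) (A : Form L) (hs : A.FreeFor x s) (ht : A.FreeFor x t) :
      BasicAxiom D ((eq s t).imp ((A.subst x s).imp (A.subst x t)))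
  | succ_ne_zero (s : Term L) : BasicAxiom D (neg (eq s.succ zero))
  | succ_inj (s t : Term L) : BasicAxiom D ((eq s.succ t.succ).imp (eq s t))
  | add_zero (s : Term L) : BasicAxiom D (eq (s.add zero) s)
  | add_succ (s t : Term L) : BasicAxiom D (eq (s.add t.succ) (s.add t).succ)
  | mul_zero (s : Term L) : BasicAxiom D (eq (s.mul zero) zero)
  | mul_succ (s t : Term L) : BasicAxiom D (eq (s.mul t.succ) ((s.mul t).add s))
  | induction (x : ℕ) (A : Form L) :
      BasicAxiom D (((A.subst x zero).and (all x (A.imp (A.subst x (var x).succ)))).imp (all x A))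
  | defining (A : Form L) (h : A ∈ D) : BasicAxiom D A

/-- Axioms of PAT: the sentences that are universal closures of basic axioms. -/
def AxPAT (D : Set (Form L)) (A : Form L) : Prop :=
  A.IsSentence ∧ ∃ (vs : List ℕ) (B : Form L), BasicAxiom D B ∧ A = vs.foldr Form.all B

end PAT

/-- `A(n)`, for a formula whose only free variable is the variable number `0`. -/
def Form.at1 (A : Form L) (n : ℕ) : Form L := A.subst 0 (.num n)

/-- `A(n, m)`, for a formula whose only free variables are the variables number `0` and `1`. -/
def Form.at2 (A : Form L) (n m : ℕ) : Form L := (A.subst 0 (.num n)).subst 1 (.num m)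

/-- The arithmetical formula `A` with one free variable represents the set `S` of numbers. -/
structure Represents (A : Form L) (S : Set ℕ) : Prop where
  arithmetical : A.Arithmetical
  fv : A.fv ⊆ {0}
  spec : ∀ n, (A.at1 n).Holds ↔ n ∈ S

/-- A choice of the formalization of syntax in the language of arithmetic: of the true arithmetical
sentences that serve as defining axioms of the function symbols, and of arithmetical formulas that
represent the sets of (Gödel numbers of) closed terms, of sentences, and of axioms of PAT, and the
relation `x° = y°` of having the same value between closed terms. -/
structure Arithmetization (L : Signature) where
  defAx : Set (Form L)
  defAx_spec : ∀ A ∈ defAx, A.IsSentence ∧ A.Arithmetical ∧ A.Holds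
  ct : Form L
  ct_spec : Represents ct (closedTermCodes L)
  sent : Form L
  sent_spec : Represents sent (sentenceCodes L)
  axPAT : Form L
  axPAT_spec : Represents axPAT {n | ∃ A : Form L, AxPAT defAx A ∧ A.code = n}
  eqVal : Form L
  eqVal_arithmetical : eqVal.Arithmetical
  eqVal_fv : eqVal.fv ⊆ {0, 1}
  eqVal_spec : ∀ s t : Term L, s.Closed → t.Closed →
    ((eqVal.at2 s.code t.code).Holds ↔ s.value = t.value)

/-! ### Sequents and the calculus VFM^∞ -/

/-- A sequent is a finite set of sentences in negation normal form. -/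
def IsSequent (Γ : Finset (Form L)) : Prop := ∀ A ∈ Γ, A.IsSentence ∧ A.IsNNF

/-- True arithmetical literals. -/
def TrueLiteral (A : Form L) : Prop :=
  (∃ s t : Term L, A = .eq s t ∧ s.Closed ∧ t.Closed ∧ s.value = t.value) ∨
    ∃ s t : Term L, A = .neg (.eq s t) ∧ s.Closed ∧ t.Closed ∧ s.value ≠ t.value

section Calculi

open Term Form

/-- The terms for the syntactic operations. -/
def dEq (s t : Term L) : Term L := app .dotEq ![s, t]
def dNeg (s : Term L) : Term L := app .dotNeg ![s]
def dOr (s t : Term L) : Term L := app .dotOr ![s, t]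
def dAll (s t : Term L) : Term L := app .dotAll ![s, t]
/-- The term for the Gödel number of the conditional. -/
def dImp (s t : Term L) : Term L := dOr (dNeg s) t
/-- The term for the result of substituting the `i`-th numeral for the variable (with number) `v`
in the formula (with number) `a`. -/
def dSub (a v : Term L) (i : ℕ) : Term L := app .dotSub ![a, app .numeral ![num i], v]
/-- The term `⌜Tr(ẋ)⌝` at `x = n`, that is, `⌜Tr(v)⌝(num(n)/⌜v⌝)`. -/
def quoteTr (n : ℕ) : Term L :=
  dSub (num (tr (var 0) : Form L).code) (num (var 0 : Term L).code) n

/-- `Derivable R k α Γ`: the sequent `Γ` is derivable in VFM^∞ with cut rank `k` and derivation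
length `α`. -/
inductive Derivable (R : Arithmetization L) (k : ℕ) : Ordinal.{0} → Finset (Form L) → Prop
  | ax1 {α Γ A} (hΓ : IsSequent (insert A Γ)) (hA : TrueLiteral A) :
      Derivable R k α (insert A Γ)
  | ax2 {α Γ s t} (hΓ : IsSequent (insert (neg (tr s)) (insert (tr t) Γ)))
      (hst : t.value = s.value) :
      Derivable R k α (insert (neg (tr s)) (insert (tr t) Γ))
  | or {α α₀ Γ A B} (h₀ : α₀ < α) (d : Derivable R k α₀ (insert A (insert B Γ))) :
      Derivable R k α (insert (or A B) Γ)
  | and {α α₀ α₁ Γ A B} (h₀ : α₀ < α) (h₁ : α₁ < α)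
      (d₀ : Derivable R k α₀ (insert A Γ)) (d₁ : Derivable R k α₁ (insert B Γ)) :
      Derivable R k α (insert (and A B) Γ)
  | ex {α α₀ Γ v A} (i : ℕ) (h₀ : α₀ < α) (d : Derivable R k α₀ (insert (A.subst v (num i)) Γ)) :
      Derivable R k α (insert (ex v A) Γ)
  | all {α Γ v A} (a : ℕ → Ordinal.{0}) (ha : ∀ i, a i < α)
      (d : ∀ i, Derivable R k (a i) (insert (A.subst v (num i)) Γ)) :
      Derivable R k α (insert (all v A) Γ)
  | cut {α α₀ α₁ Γ A} (h₀ : α₀ < α) (h₁ : α₁ < α) (hA : A.co < k)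
      (d₀ : Derivable R k α₀ (insert A Γ)) (d₁ : Derivable R k α₁ (insert (neg A).nnf Γ)) :
      Derivable R k α Γ
  | tr_eq {α α₀ Γ} (n m : ℕ) {t} (h₀ : α₀ < α) (ht : t.Closed)
      (htv : t.value = (dEq (num n) (num m) : Term L).value)
      (d : Derivable R k α₀
        (insert (((R.ct.at1 n).and (R.ct.at1 m)).and (R.eqVal.at2 n m)).nnf Γ)) :
      Derivable R k α (insert (tr t) Γ)
  | tr_ne {α α₀ Γ} (n m : ℕ) (h₀ : α₀ < α)
      (d : Derivable R k α₀
        (insert ((((R.ct.at1 n).and (R.ct.at1 m)).and (tr (dEq (num n) (num m)))).and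
          (neg (R.eqVal.at2 n m))).nnf Γ)) :
      Derivable R k α Γ
  | tr_imp {α α₀ α₁ Γ} (n m : ℕ) {t} (h₀ : α₀ < α) (h₁ : α₁ < α) (ht : t.Closed)
      (htv : t.value = m)
      (d₀ : Derivable R k α₀ (insert (tr (num n)) Γ))
      (d₁ : Derivable R k α₁ (insert (tr (dImp (num n) (num m))) Γ)) :
      Derivable R k α (insert (tr t) Γ)
  | tr_all {α Γ} (n m : ℕ) {t} (a : ℕ → Ordinal.{0}) (ha : ∀ i, a i < α) (ht : t.Closed)
      (htv : t.value = (dAll (num m) (num n) : Term L).value)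
      (d : ∀ i, Derivable R k (a i) (insert (tr (dSub (num n) (num m) i)) Γ)) :
      Derivable R k α (insert (tr t) Γ)
  | rep {α α₀ Γ} (n : ℕ) {t} (h₀ : α₀ < α) (ht : t.Closed)
      (htv : t.value = (quoteTr n : Term L).value)
      (d : Derivable R k α₀ (insert (tr (num n)) Γ)) :
      Derivable R k α (insert (tr t) Γ)
  | del {α α₀ Γ} (n : ℕ) {t} (h₀ : α₀ < α) (ht : t.Closed) (htv : t.value = n)
      (d : Derivable R k α₀ (insert (tr (quoteTr n)) Γ)) :
      Derivable R k α (insert (tr t) Γ)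
  | tr_cons {α Γ} (n : ℕ) {t} (hΓ : IsSequent (insert (tr t) Γ))
      (htv : t.value = (neg ((tr (num n)).and (tr (dNeg (num n)))) : Form L).code) :
      Derivable R k α (insert (tr t) Γ)
  | tr_comp {α Γ} (n : ℕ) {t} (hΓ : IsSequent (insert (tr t) Γ))
      (htv : t.value = ((R.sent.at1 n).imp ((tr (num n)).or (tr (dNeg (num n))))).code) :
      Derivable R k α (insert (tr t) Γ)
  | tr_norm {α Γ} (n : ℕ) {t} (hΓ : IsSequent (insert (tr t) Γ))
      (htv : t.value = ((tr (num n)).imp (R.sent.at1 n)).code) :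
      Derivable R k α (insert (tr t) Γ)
  | tr_pat {α α₀ Γ} (n : ℕ) {t} (h₀ : α₀ < α) (ht : t.Closed) (htv : t.value = n)
      (d : Derivable R k α₀ (insert (R.axPAT.at1 n).nnf Γ)) :
      Derivable R k α (insert (tr t) Γ)
  | cons {α α₀ Γ} (n : ℕ) (h₀ : α₀ < α)
      (d₀ : Derivable R k α₀ (insert (tr (num n)) Γ))
      (d₁ : Derivable R k α₀ (insert (tr (dNeg (num n))) Γ)) :
      Derivable R k α Γ

/-! ### The sequent system `I` and satisfaction at a level -/

/-- The relation `I(i; α; β; Γ)`: the sequent `Γ` has a derivation of height `β` with at most `α`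
nested applications of the rule `trIntro`; the index `i = 0` means that the rules `cons` and `norm`
are not used. -/
inductive I : Fin 2 → Ordinal.{0} → Ordinal.{0} → Finset (Form L) → Prop
  | ax1 {i α β Γ s t} (hΓ : IsSequent (insert (eq s t) Γ)) (h : s.value = t.value) :
      I i α β (insert (eq s t) Γ)
  | ax2 {i α β Γ s t} (hΓ : IsSequent (insert (neg (eq s t)) Γ)) (h : s.value ≠ t.value) :
      I i α β (insert (neg (eq s t)) Γ)
  | ax3 {i α β Γ s t} (hΓ : IsSequent (insert (tr s) (insert (neg (tr t)) Γ)))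
      (h : t.value = s.value) :
      I i α β (insert (tr s) (insert (neg (tr t)) Γ))
  | or {i α β β₀ Γ A B} (hβ : β₀ < β) (d : I i α β₀ (insert A (insert B Γ))) :
      I i α β (insert (or A B) Γ)
  | and {i α β β₀ Γ A B} (hβ : β₀ < β) (d₀ : I i α β₀ (insert A Γ)) (d₁ : I i α β₀ (insert B Γ)) :
      I i α β (insert (and A B) Γ)
  | ex {i α β β₀ Γ v A} (n : ℕ) (hβ : β₀ < β) (d : I i α β₀ (insert (A.subst v (num n)) Γ)) :
      I i α β (insert (ex v A) Γ)
  | all {i α β Γ v A} (b : ℕ → Ordinal.{0}) (hb : ∀ n, b n < β)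
      (d : ∀ n, I i α (b n) (insert (A.subst v (num n)) Γ)) :
      I i α β (insert (all v A) Γ)
  | trIntro {i α α₀ β β₀ Γ t} (A : Form L) (hα : α₀ < α) (hβ : β₀ < β)
      (hΓ : IsSequent (insert (tr t) Γ)) (hA : A.IsSentence) (ht : t.value = A.code)
      (d : I i α₀ β₀ {A.nnf}) :
      I i α β (insert (tr t) Γ)
  | comp {i α β Γ s t} (A : Form L) (hΓ : IsSequent (insert (tr s) (insert (tr t) Γ)))
      (hA : A.IsSentence) (hs : s.value = A.code) (ht : t.value = (neg A).code) :
      I i α β (insert (tr s) (insert (tr t) Γ))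
  | cons {i α β β₀ Γ} (n : ℕ) (hβ : β₀ < β) (d₀ : I i α β₀ (insert (tr (num n)) Γ))
      (d₁ : I i α β₀ (insert (tr (dNeg (num n))) Γ)) :
      I 1 α β Γ
  | norm {i α β β₀ Γ} (n : ℕ) (hβ : β₀ < β) (hn : n ∉ sentenceCodes L)
      (d : I i α β₀ (insert (tr (num n)) Γ)) :
      I 1 α β Γ

/-- `Satisfied α A`: the Tr-positive sentence `A` is satisfied at level `α`. Here `ε_ α` is the
`α`-th epsilon number. -/
inductive Satisfied (α : Ordinal.{0}) : Form L → Prop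
  | eq {s t} (h : s.value = t.value) : Satisfied α (eq s t)
  | ne {s t} (h : s.value ≠ t.value) : Satisfied α (neg (eq s t))
  | tr {t} (A : Form L) (hA : A.IsSentence) (ht : t.value = A.code)
      (h : I 1 α (ε_ α) {A.nnf}) : Satisfied α (tr t)
  | and {A B} (hA : Satisfied α A) (hB : Satisfied α B) : Satisfied α (and A B)
  | or_left {A B} (hA : Satisfied α A) : Satisfied α (or A B)
  | or_right {A B} (hB : Satisfied α B) : Satisfied α (or A B)
  | all {v A} (h : ∀ n, Satisfied α (A.subst v (num n))) : Satisfied α (all v A)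
  | ex {v A} (n : ℕ) (h : Satisfied α (A.subst v (num n))) : Satisfied α (ex v A)

end Calculi

/-- A Tr-positive sequent is satisfied at level `α` if one of its members is. -/
def SequentSatisfied (α : Ordinal.{0}) (Γ : Finset (Form L)) : Prop := ∃ A ∈ Γ, Satisfied α A

end VFM

/-!
The proof goes by induction on the derivation in `VFM^∞`: without cuts, all sequents in the
derivation of a Tr-positive sequent are Tr-positive, so it remains to see that every rule leads
from sequents satisfied at levels below `α` to a sequent satisfied at level `α`
(`Derivable.sequentSatisfied`). The logical rules are immediate. For the rules about truth, closure
properties of `I(1; α; ε_α; ·)` are needed, of three kinds.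

*Closure under modus ponens* (rule `tr_imp`) is cut elimination. The calculus `Der` is `I` at a
fixed level with cuts added. Cuts on compound formulas are reduced as usual, and a cut on `Tr(t)` is
harmless since `¬ Tr(t)` is principal only in initial sequents (`Der.reduce`). Lowering the cut rank
by one raises the height from `β` to `ω ^ β`, so heights remain below any epsilon number
(`Der.I_epsilon`).

*Consistency and inversion* (rules `cons`, `tr_ne` and `del`) are obtained semantically. Every
derivation is sound for the interpretations of `Tr` by a set of sentences that contains exactly one
of `A`, `¬ A` for each `A` and contains the sentences `A` with a derivation of smaller level and
smaller height (`Der.sound`). Such a set need not be closed under logic, so it exists as soon as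
the sentences with such derivations do not contradict each other outright, and this holds by
induction on the level (`theory_consistent`). If a sentence has no such derivation, a set that
omits it can be chosen; hence a derivable `Tr⌜A⌝` is always about a sentence `A` derivable with
smaller level and height (`Der.exists_mem_theory`).

*Derivability of axioms* (rules `tr_eq`, `tr_pat`, `tr_cons`, `tr_comp`, `tr_norm`): true
arithmetical sentences and the axioms of PAT have derivations of height below `ω ^ 2`
(`prov_of_sat`, `prov_axPAT`). Basic axioms are closed under substitution of numerals, which deals
with universal closures by the `ω`-rule.
-/

namespace VFM

open scoped Ordinal

variable {L : Signature}

/-! ### Substitution, free variables and negation normal forms -/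

namespace Term

theorem closed_num (n : ℕ) : (num n : Term L).Closed := by
  induction n with
  | zero => simp [Closed, num, zero, vars, FSym.arity]
  | succ n ih =>
    simp only [Closed] at ih
    simp [Closed, num, succ, vars, FSym.arity, ih]

theorem closed_zero : (zero : Term L).Closed := closed_num 0

theorem value_num (n : ℕ) : (num n : Term L).value = n := by
  induction n with
  | zero => simp [value, num, zero, val, FSym.interp]
  | succ n ih =>
    simp only [value] at ih
    simp [value, num, succ, val, FSym.interp, ih]

theorem subst_of_notMem_vars {t : Term L} {x : ℕ} (r : Term L) (h : x ∉ t.vars) :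
    t.subst x r = t := by
  induction t with
  | var v =>
    have : v ≠ x := fun e => h (by simp [vars, e])
    simp [subst, this]
  | app f ts ih =>
    simp only [vars, Set.mem_iUnion, not_exists] at h
    simp only [subst]
    congr 1
    funext i
    exact ih i (h i)

theorem Closed.subst_eq {t : Term L} (h : t.Closed) (x : ℕ) (r : Term L) : t.subst x r = t :=
  subst_of_notMem_vars r (by simp only [Closed] at h; simp [h])

theorem vars_subst {r : Term L} (hr : r.Closed) (t : Term L) (x : ℕ) :
    (t.subst x r).vars = t.vars \ {x} := by
  induction t with
  | var v =>
    simp only [Closed] at hr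
    by_cases h : v = x
    · simp [subst, vars, h, hr]
    · ext w
      simp only [subst, vars, h, if_false, Set.mem_singleton_iff, Set.mem_sdiff]
      constructor
      · rintro rfl
        exact ⟨rfl, h⟩
      · exact And.left
  | app f ts ih => simp only [subst, vars, ih, Set.iUnion_sdiff]

theorem vars_subset_vars_subst {t r : Term L} {x : ℕ} (h : x ∈ t.vars) :
    r.vars ⊆ (t.subst x r).vars := by
  induction t with
  | var v =>
    obtain rfl : x = v := h
    simp [subst]
  | app f ts ih =>
    simp only [vars, Set.mem_iUnion] at h
    obtain ⟨i, hi⟩ := h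
    simp only [subst, vars]
    exact (ih i hi).trans (Set.subset_iUnion (fun i => ((ts i).subst x r).vars) i)

theorem val_subst (e : ℕ → ℕ) (t : Term L) (x : ℕ) (r : Term L) :
    (t.subst x r).val e = t.val (Function.update e x (r.val e)) := by
  induction t with
  | var v =>
    by_cases h : v = x
    · subst h
      simp [subst, val]
    · simp [subst, val, h]
  | app f ts ih => simp only [subst, val, ih]

theorem val_congr {e e' : ℕ → ℕ} {t : Term L} (h : ∀ v ∈ t.vars, e v = e' v) :
    t.val e = t.val e' := by
  induction t with
  | var v => exact h v rfl
  | app f ts ih =>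
    simp only [val]
    congr 1
    funext i
    exact ih i fun v hv => h v (Set.mem_iUnion.2 ⟨i, hv⟩)

theorem Closed.val_eq {t : Term L} (h : t.Closed) (e : ℕ → ℕ) : t.val e = t.value :=
  val_congr (by simp only [Closed] at h; simp [h])

theorem subst_comm (t : Term L) {x y : ℕ} (hxy : x ≠ y) (r : Term L) {q : Term L}
    (hq : q.Closed) :
    (t.subst x r).subst y q = (t.subst y q).subst x (r.subst y q) := by
  induction t with
  | var v =>
    by_cases h : v = x
    · subst h
      simp [subst, hxy]
    · by_cases h' : v = y
      · subst h'
        simp [subst, h, hq.subst_eq]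
      · simp [subst, h, h']
  | app f ts ih => simp only [subst, ih]

theorem subst_subst_self (t : Term L) (x : ℕ) (r q : Term L) :
    (t.subst x r).subst x q = t.subst x (r.subst x q) := by
  induction t with
  | var v =>
    by_cases h : v = x
    · simp [subst, h]
    · simp [subst, h]
  | app f ts ih => simp only [subst, ih]

end Term

namespace Form

open Term

theorem subst_of_notMem_fv {A : Form L} {x : ℕ} (r : Term L) (h : x ∉ A.fv) :
    A.subst x r = A := by
  induction A with
  | eq s t =>
    simp only [fv, Set.mem_union, not_or] at h
    simp [subst, subst_of_notMem_vars r h.1, subst_of_notMem_vars r h.2]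
  | tr t => simp [subst, subst_of_notMem_vars r h]
  | neg A ih => simp [subst, ih h]
  | and A B ihA ihB =>
    simp only [fv, Set.mem_union, not_or] at h
    simp [subst, ihA h.1, ihB h.2]
  | or A B ihA ihB =>
    simp only [fv, Set.mem_union, not_or] at h
    simp [subst, ihA h.1, ihB h.2]
  | all v A ih =>
    by_cases e : v = x
    · simp [subst, e]
    · have : x ∉ A.fv := fun hx => h ⟨hx, fun e' => e e'.symm⟩
      simp [subst, e, ih this]
  | ex v A ih =>
    by_cases e : v = x
    · simp [subst, e]
    · have : x ∉ A.fv := fun hx => h ⟨hx, fun e' => e e'.symm⟩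
      simp [subst, e, ih this]

theorem IsSentence.subst_eq {A : Form L} (h : A.IsSentence) (x : ℕ) (r : Term L) :
    A.subst x r = A :=
  subst_of_notMem_fv r (by simp only [IsSentence] at h; simp [h])

theorem fv_subst {r : Term L} (hr : r.Closed) (A : Form L) (x : ℕ) :
    (A.subst x r).fv = A.fv \ {x} := by
  induction A with
  | eq s t => simp only [subst, fv, vars_subst hr, Set.union_sdiff_distrib]
  | tr t => simp only [subst, fv, vars_subst hr]
  | neg A ih => simpa only [subst, fv] using ih
  | and A B ihA ihB => simp only [subst, fv, ihA, ihB, Set.union_sdiff_distrib]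
  | or A B ihA ihB => simp only [subst, fv, ihA, ihB, Set.union_sdiff_distrib]
  | all v A ih =>
    by_cases e : v = x
    · simp [subst, fv, e]
    · simp only [subst, fv, e, if_false, ih]
      exact sdiff_right_comm _ _ _
  | ex v A ih =>
    by_cases e : v = x
    · simp [subst, fv, e]
    · simp only [subst, fv, e, if_false, ih]
      exact sdiff_right_comm _ _ _

/-- A closed instance `A(r/x)` is a sentence precisely when no variable other than `x` is free in
`A`. -/
theorem isSentence_subst_iff {r : Term L} (hr : r.Closed) {A : Form L} {x : ℕ} :
    (A.subst x r).IsSentence ↔ A.fv \ {x} = ∅ := by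
  rw [IsSentence, fv_subst hr]

theorem vars_subset_fv_subst {A : Form L} {x : ℕ} {t : Term L} (h : A.FreeFor x t)
    (hx : x ∈ A.fv) : t.vars ⊆ (A.subst x t).fv := by
  induction A with
  | eq r s =>
    rcases hx with hx | hx
    · exact (vars_subset_vars_subst hx).trans Set.subset_union_left
    · exact (vars_subset_vars_subst hx).trans Set.subset_union_right
  | tr r => exact vars_subset_vars_subst hx
  | neg A ih => exact ih h hx
  | and A B ihA ihB =>
    rcases hx with hx | hx
    · exact (ihA h.1 hx).trans Set.subset_union_left
    · exact (ihB h.2 hx).trans Set.subset_union_right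
  | or A B ihA ihB =>
    rcases hx with hx | hx
    · exact (ihA h.1 hx).trans Set.subset_union_left
    · exact (ihB h.2 hx).trans Set.subset_union_right
  | all v A ih =>
    rcases h with h | ⟨hv, h⟩
    · exact absurd hx h
    · have e : v ≠ x := fun e => hx.2 e.symm
      simp only [subst, e, if_false, fv]
      exact fun w hw => ⟨ih h hx.1 hw, fun e' => hv (e' ▸ hw)⟩
  | ex v A ih =>
    rcases h with h | ⟨hv, h⟩
    · exact absurd hx h
    · have e : v ≠ x := fun e => hx.2 e.symm
      simp only [subst, e, if_false, fv]
      exact fun w hw => ⟨ih h hx.1 hw, fun e' => hv (e' ▸ hw)⟩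

/-- An instance that is a sentence may be taken to be formed with a closed term. -/
theorem exists_closed_subst_eq {A : Form L} {x : ℕ} {t : Term L} (h : A.FreeFor x t)
    (hA : (A.subst x t).IsSentence) : ∃ r : Term L, r.Closed ∧ A.subst x t = A.subst x r := by
  by_cases hx : x ∈ A.fv
  · refine ⟨t, ?_, rfl⟩
    have := vars_subset_fv_subst h hx
    rw [IsSentence] at hA
    rw [hA] at this
    exact Set.subset_empty_iff.1 this
  · exact ⟨zero, closed_zero, by rw [subst_of_notMem_fv _ hx, subst_of_notMem_fv _ hx]⟩

theorem subst_comm {A : Form L} {x y : ℕ} (hxy : x ≠ y) {r q : Term L} (hq : q.Closed)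
    (h : A.FreeFor x r) :
    (A.subst x r).subst y q = (A.subst y q).subst x (r.subst y q) := by
  induction A with
  | eq s t => simp only [subst, Term.subst_comm _ hxy r hq]
  | tr t => simp only [subst, Term.subst_comm _ hxy r hq]
  | neg A ih => simp only [subst, ih h]
  | and A B ihA ihB => simp only [subst, ihA h.1, ihB h.2]
  | or A B ihA ihB => simp only [subst, ihA h.1, ihB h.2]
  | all v A ih =>
    rcases h with h | ⟨hv, h⟩
    · have h' : x ∉ ((all v A).subst y q).fv := by
        rw [fv_subst hq]
        exact fun h'' => h h''.1
      rw [subst_of_notMem_fv _ h, subst_of_notMem_fv _ h']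
    · by_cases e : v = x
      · subst e
        simp [subst, hxy]
      · by_cases e' : v = y
        · subst e'
          simp [subst, e, subst_of_notMem_vars q hv]
        · simp [subst, e, e', ih h]
  | ex v A ih =>
    rcases h with h | ⟨hv, h⟩
    · have h' : x ∉ ((ex v A).subst y q).fv := by
        rw [fv_subst hq]
        exact fun h'' => h h''.1
      rw [subst_of_notMem_fv _ h, subst_of_notMem_fv _ h']
    · by_cases e : v = x
      · subst e
        simp [subst, hxy]
      · by_cases e' : v = y
        · subst e'
          simp [subst, e, subst_of_notMem_vars q hv]
        · simp [subst, e, e', ih h]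

theorem subst_subst_self (A : Form L) (x : ℕ) (r q : Term L) :
    (A.subst x r).subst x q = A.subst x (r.subst x q) := by
  induction A with
  | eq s t => simp only [subst, Term.subst_subst_self]
  | tr t => simp only [subst, Term.subst_subst_self]
  | neg A ih => simp only [subst, ih]
  | and A B ihA ihB => simp only [subst, ihA, ihB]
  | or A B ihA ihB => simp only [subst, ihA, ihB]
  | all v A ih => by_cases e : v = x <;> simp [subst, e, ih]
  | ex v A ih => by_cases e : v = x <;> simp [subst, e, ih]

theorem FreeFor.mono {A : Form L} {x : ℕ} {t t' : Term L} (h : A.FreeFor x t)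
    (ht : t'.vars ⊆ t.vars) : A.FreeFor x t' := by
  induction A with
  | eq | tr => trivial
  | neg A ih => exact ih h
  | and A B ihA ihB => exact ⟨ihA h.1, ihB h.2⟩
  | or A B ihA ihB => exact ⟨ihA h.1, ihB h.2⟩
  | all v A ih => exact h.imp id fun h => ⟨fun hv => h.1 (ht hv), ih h.2⟩
  | ex v A ih => exact h.imp id fun h => ⟨fun hv => h.1 (ht hv), ih h.2⟩

/-- Only variables other than `x` can be captured, as the variable `x` itself is never replaced
within the scope of a quantifier that binds it. -/
theorem freeFor_of_vars_subset {t : Term L} {x : ℕ} (ht : t.vars ⊆ {x}) (A : Form L) :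
    A.FreeFor x t := by
  induction A with
  | eq | tr => trivial
  | neg A ih => exact ih
  | and A B ihA ihB => exact ⟨ihA, ihB⟩
  | or A B ihA ihB => exact ⟨ihA, ihB⟩
  | all v A ih =>
    by_cases e : v = x
    · exact Or.inl fun h => h.2 e.symm
    · exact Or.inr ⟨fun h => e (ht h), ih⟩
  | ex v A ih =>
    by_cases e : v = x
    · exact Or.inl fun h => h.2 e.symm
    · exact Or.inr ⟨fun h => e (ht h), ih⟩

theorem freeFor_of_closed {t : Term L} (ht : t.Closed) (A : Form L) (x : ℕ) :
    A.FreeFor x t :=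
  freeFor_of_vars_subset (by rw [ht]; exact Set.empty_subset _) A

theorem FreeFor.subst {A : Form L} {x : ℕ} {t : Term L} (h : A.FreeFor x t) (y : ℕ)
    {q : Term L} (hq : q.Closed) : (A.subst y q).FreeFor x t := by
  induction A with
  | eq | tr => trivial
  | neg A ih => exact ih h
  | and A B ihA ihB => exact ⟨ihA h.1, ihB h.2⟩
  | or A B ihA ihB => exact ⟨ihA h.1, ihB h.2⟩
  | all v A ih =>
    by_cases e : v = y
    · simpa [Form.subst, e] using h
    · simp only [Form.subst, e, if_false]
      refine h.imp (fun h h' => h ?_) fun h => ⟨h.1, ih h.2⟩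
      simp only [fv, fv_subst hq] at h' ⊢
      exact ⟨h'.1.1, h'.2⟩
  | ex v A ih =>
    by_cases e : v = y
    · simpa [Form.subst, e] using h
    · simp only [Form.subst, e, if_false]
      refine h.imp (fun h h' => h ?_) fun h => ⟨h.1, ih h.2⟩
      simp only [fv, fv_subst hq] at h' ⊢
      exact ⟨h'.1.1, h'.2⟩

/-- The number of connectives, quantifiers and atoms. Unlike `co`, it also drops when a negation is
removed. -/
def size : Form L → ℕ
  | eq _ _ => 1
  | tr _ => 1
  | neg A => size A + 1
  | and A B => size A + size B + 1
  | or A B => size A + size B + 1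
  | all _ A => size A + 1
  | ex _ A => size A + 1

theorem size_subst (A : Form L) (x : ℕ) (t : Term L) : (A.subst x t).size = A.size := by
  induction A with
  | eq | tr => rfl
  | neg A ih => simp [subst, size, ih]
  | and A B ihA ihB => simp [subst, size, ihA, ihB]
  | or A B ihA ihB => simp [subst, size, ihA, ihB]
  | all v A ih => by_cases e : v = x <;> simp [subst, e, size, ih]
  | ex v A ih => by_cases e : v = x <;> simp [subst, e, size, ih]

theorem co_subst (A : Form L) (x : ℕ) (t : Term L) : (A.subst x t).co = A.co := by
  induction A with
  | eq | tr => rfl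
  | neg A ih => simp [subst, co, ih]
  | and A B ihA ihB => simp [subst, co, ihA, ihB]
  | or A B ihA ihB => simp [subst, co, ihA, ihB]
  | all v A ih => by_cases e : v = x <;> simp [subst, e, co, ih]
  | ex v A ih => by_cases e : v = x <;> simp [subst, e, co, ih]

theorem arithmetical_subst {A : Form L} (h : A.Arithmetical) (x : ℕ) (t : Term L) :
    (A.subst x t).Arithmetical := by
  induction A with
  | eq => trivial
  | tr => exact h
  | neg A ih => exact ih h
  | and A B ihA ihB => exact ⟨ihA h.1, ihB h.2⟩
  | or A B ihA ihB => exact ⟨ihA h.1, ihB h.2⟩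
  | all v A ih =>
    by_cases e : v = x
    · simpa [subst, e] using h
    · simp only [subst, e, if_false]
      exact ih h
  | ex v A ih =>
    by_cases e : v = x
    · simpa [subst, e] using h
    · simp only [subst, e, if_false]
      exact ih h

theorem isNNF_subst {A : Form L} {x : ℕ} {t : Term L} : (A.subst x t).IsNNF ↔ A.IsNNF := by
  induction A with
  | eq | tr => rfl
  | neg A =>
    cases A with
    | all v => by_cases e : v = x <;> simp [subst, e, IsNNF]
    | ex v => by_cases e : v = x <;> simp [subst, e, IsNNF]
    | _ => rfl
  | and A B ihA ihB => simp only [subst, IsNNF, ihA, ihB]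
  | or A B ihA ihB => simp only [subst, IsNNF, ihA, ihB]
  | all v A ih =>
    by_cases e : v = x
    · simp [subst, e]
    · simp only [subst, e, if_false]
      exact ih
  | ex v A ih =>
    by_cases e : v = x
    · simp [subst, e]
    · simp only [subst, e, if_false]
      exact ih

theorem trPositive_subst {A : Form L} {x : ℕ} {t : Term L} (h : A.TrPositive) :
    (A.subst x t).TrPositive := by
  induction A with
  | eq | tr => trivial
  | neg A => cases A <;> first | exact h | exact h.elim
  | and A B ihA ihB => exact ⟨ihA h.1, ihB h.2⟩
  | or A B ihA ihB => exact ⟨ihA h.1, ihB h.2⟩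
  | all v A ih =>
    by_cases e : v = x
    · simpa [subst, e] using h
    · simp only [subst, e, if_false]
      exact ih h
  | ex v A ih =>
    by_cases e : v = x
    · simpa [subst, e] using h
    · simp only [subst, e, if_false]
      exact ih h

theorem nnfSigned_subst (A : Form L) (b : Bool) (x : ℕ) (t : Term L) :
    (A.subst x t).nnfSigned b = (A.nnfSigned b).subst x t := by
  induction A generalizing b with
  | eq | tr => cases b <;> rfl
  | neg A ih => cases b <;> simp only [subst, nnfSigned, ih]
  | and A B ihA ihB => cases b <;> simp only [subst, nnfSigned, ihA, ihB]
  | or A B ihA ihB => cases b <;> simp only [subst, nnfSigned, ihA, ihB]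
  | all v A ih => by_cases e : v = x <;> cases b <;> simp [subst, nnfSigned, e, ih]
  | ex v A ih => by_cases e : v = x <;> cases b <;> simp [subst, nnfSigned, e, ih]

theorem isNNF_nnfSigned (A : Form L) (b : Bool) : (A.nnfSigned b).IsNNF := by
  induction A generalizing b with
  | eq | tr => cases b <;> trivial
  | neg A ih => cases b <;> exact ih _
  | and A B ihA ihB => cases b <;> exact ⟨ihA _, ihB _⟩
  | or A B ihA ihB => cases b <;> exact ⟨ihA _, ihB _⟩
  | all v A ih => cases b <;> exact ih _
  | ex v A ih => cases b <;> exact ih _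

theorem fv_nnfSigned (A : Form L) (b : Bool) : (A.nnfSigned b).fv = A.fv := by
  induction A generalizing b with
  | eq | tr => cases b <;> rfl
  | neg A ih => cases b <;> exact ih _
  | and A B ihA ihB => cases b <;> simp only [nnfSigned, fv, ihA, ihB]
  | or A B ihA ihB => cases b <;> simp only [nnfSigned, fv, ihA, ihB]
  | all v A ih => cases b <;> simp only [nnfSigned, fv, ih]
  | ex v A ih => cases b <;> simp only [nnfSigned, fv, ih]

theorem IsSentence.nnfSigned {A : Form L} (h : A.IsSentence) (b : Bool) :
    (A.nnfSigned b).IsSentence := by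
  rw [IsSentence, fv_nnfSigned]
  exact h

theorem trPositive_nnfSigned {A : Form L} (h : A.Arithmetical) (b : Bool) :
    (A.nnfSigned b).TrPositive := by
  induction A generalizing b with
  | eq => cases b <;> trivial
  | tr => exact h.elim
  | neg A ih => cases b <;> exact ih h _
  | and A B ihA ihB => cases b <;> exact ⟨ihA h.1 _, ihB h.2 _⟩
  | or A B ihA ihB => cases b <;> exact ⟨ihA h.1 _, ihB h.2 _⟩
  | all v A ih => cases b <;> exact ih h _
  | ex v A ih => cases b <;> exact ih h _

theorem arithmetical_nnfSigned {A : Form L} (h : A.Arithmetical) (b : Bool) :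
    (A.nnfSigned b).Arithmetical := by
  induction A generalizing b with
  | eq => cases b <;> trivial
  | tr => exact h.elim
  | neg A ih => cases b <;> exact ih h _
  | and A B ihA ihB => cases b <;> exact ⟨ihA h.1 _, ihB h.2 _⟩
  | or A B ihA ihB => cases b <;> exact ⟨ihA h.1 _, ihB h.2 _⟩
  | all v A ih => cases b <;> exact ih h _
  | ex v A ih => cases b <;> exact ih h _

theorem sat_subst {X : Set ℕ} {A : Form L} {x : ℕ} {t : Term L} (ht : t.Closed) (e : ℕ → ℕ) :
    (A.subst x t).Sat X e ↔ A.Sat X (Function.update e x t.value) := by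
  induction A generalizing e with
  | eq => simp only [subst, Sat, val_subst, ht.val_eq e]
  | tr => simp only [subst, Sat, val_subst, ht.val_eq e]
  | neg A ih => simp only [subst, Sat, ih]
  | and A B ihA ihB => simp only [subst, Sat, ihA, ihB]
  | or A B ihA ihB => simp only [subst, Sat, ihA, ihB]
  | all v A ih =>
    by_cases h : v = x
    · simp [subst, h, Sat]
    · simp only [subst, h, if_false, Sat, ih]
      simp only [Function.update_comm h]
  | ex v A ih =>
    by_cases h : v = x
    · simp [subst, h, Sat]
    · simp only [subst, h, if_false, Sat, ih]
      simp only [Function.update_comm h]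

theorem sat_nnfSigned {X : Set ℕ} {A : Form L} (e : ℕ → ℕ) :
    ((A.nnfSigned true).Sat X e ↔ A.Sat X e) ∧ ((A.nnfSigned false).Sat X e ↔ ¬ A.Sat X e) := by
  induction A generalizing e with
  | eq | tr => exact ⟨Iff.rfl, Iff.rfl⟩
  | neg A ih => simp only [nnfSigned, Sat, ih, not_not, and_self]
  | and A B ihA ihB =>
    simp only [nnfSigned, Sat, ihA, ihB, not_and_or, and_self]
  | or A B ihA ihB => simp only [nnfSigned, Sat, ihA, ihB, not_or, and_self]
  | all v A ih => simp only [nnfSigned, Sat, ih, not_forall, and_self]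
  | ex v A ih => simp only [nnfSigned, Sat, ih, not_exists, and_self]

end Form

/-! ### A uniform calculus with cut -/

theorem isSequent_insert {A : Form L} {Γ : Finset (Form L)} :
    IsSequent (insert A Γ) ↔ (A.IsSentence ∧ A.IsNNF) ∧ IsSequent Γ :=
  Finset.forall_mem_insert _ _ _

theorem isSequent_singleton {A : Form L} :
    IsSequent {A} ↔ A.IsSentence ∧ A.IsNNF := by simp [IsSequent]

theorem IsSequent.mono {Γ Δ : Finset (Form L)} (h : IsSequent Γ) (hs : Δ ⊆ Γ) : IsSequent Δ :=
  fun A hA => h A (hs hA)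

theorem closed_dNeg_num (n : ℕ) : (dNeg (Term.num n) : Term L).Closed := by
  have := Term.closed_num (L := L) n
  simp only [Term.Closed] at this
  simp [Term.Closed, dNeg, Term.vars, FSym.arity, this]

theorem value_dNeg_num (n : ℕ) : (dNeg (Term.num n) : Term L).value = mkNeg n := by
  have := Term.value_num (L := L) n
  simp only [Term.value] at this
  simp [Term.value, dNeg, Term.val, FSym.interp, this]

theorem isSequent_insert_tr {t : Term L} {Γ : Finset (Form L)} (ht : t.Closed)
    (h : IsSequent Γ) : IsSequent (insert (.tr t) Γ) :=
  isSequent_insert.2 ⟨⟨ht, trivial⟩, h⟩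

section Calculus

open Form Term

/-- `Conj C F`: the formula `C` is of conjunctive type, with the instances `F n`. The family
attached to a binary conjunction repeats the second conjunct. -/
inductive Conj : Form L → (ℕ → Form L) → Prop
  | and (A B) : Conj (and A B) (fun n => if n = 0 then A else B)
  | all (v A) : Conj (all v A) (fun n => A.subst v (num n))

/-- `Disj C F`: the formula `C` is of disjunctive type, with the instances `F n`. -/
inductive Disj : Form L → (ℕ → Form L) → Prop
  | or (A B) : Disj (or A B) (fun n => if n = 0 then A else B)
  | ex (v A) : Disj (ex v A) (fun n => A.subst v (num n))

theorem Conj.unique {C : Form L} {F G} (h : Conj C F) (h' : Conj C G) : F = G := by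
  cases h <;> cases h' <;> rfl

theorem Disj.unique {C : Form L} {F G} (h : Disj C F) (h' : Disj C G) : F = G := by
  cases h <;> cases h' <;> rfl

theorem Conj.not_disj {C : Form L} {F G} (h : Conj C F) (h' : Disj C G) : False := by
  cases h <;> cases h'

theorem Conj.co_ne_zero {C : Form L} {F} (h : Conj C F) : C.co ≠ 0 := by
  cases h <;> simp [co]

theorem Disj.co_ne_zero {C : Form L} {F} (h : Disj C F) : C.co ≠ 0 := by
  cases h <;> simp [co]

theorem isSentence_and {A B : Form L} :
    (and A B).IsSentence ↔ A.IsSentence ∧ B.IsSentence := Set.union_empty_iff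

theorem isSentence_or {A B : Form L} :
    (or A B).IsSentence ↔ A.IsSentence ∧ B.IsSentence := Set.union_empty_iff

theorem isSentence_imp {A B : Form L} :
    (A.imp B).IsSentence ↔ A.IsSentence ∧ B.IsSentence := Set.union_empty_iff

theorem isSentence_all_iff {v : ℕ} {A : Form L} {t : Term L} (ht : t.Closed) :
    (all v A).IsSentence ↔ (A.subst v t).IsSentence := (isSentence_subst_iff ht).symm

theorem isSentence_ex_iff {v : ℕ} {A : Form L} {t : Term L} (ht : t.Closed) :
    (ex v A).IsSentence ↔ (A.subst v t).IsSentence := (isSentence_subst_iff ht).symm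

theorem Conj.good {C : Form L} {F} (h : Conj C F) (hC : C.IsSentence ∧ C.IsNNF) (n : ℕ) :
    (F n).IsSentence ∧ (F n).IsNNF := by
  cases h with
  | and A B =>
    obtain ⟨h1, h2⟩ := hC
    rw [isSentence_and] at h1
    by_cases e : n = 0 <;> simp only [e, if_true, if_false]
    exacts [⟨h1.1, h2.1⟩, ⟨h1.2, h2.2⟩]
  | all v A => exact ⟨(isSentence_all_iff (closed_num n)).1 hC.1, isNNF_subst.2 hC.2⟩

theorem Disj.good {C : Form L} {F} (h : Disj C F) (hC : C.IsSentence ∧ C.IsNNF) (n : ℕ) :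
    (F n).IsSentence ∧ (F n).IsNNF := by
  cases h with
  | or A B =>
    obtain ⟨h1, h2⟩ := hC
    rw [isSentence_or] at h1
    by_cases e : n = 0 <;> simp only [e, if_true, if_false]
    exacts [⟨h1.1, h2.1⟩, ⟨h1.2, h2.2⟩]
  | ex v A => exact ⟨(isSentence_ex_iff (closed_num n)).1 hC.1, isNNF_subst.2 hC.2⟩

/-- The sentences that have an `I`-derivation of level below `α` and height below `β`: those whose
truth the rule `trIntro` may assert in derivations of level `α` and height `β`. -/
def Theory (α β : Ordinal.{0}) : Set (Form L) :=
  {A | A.IsSentence ∧ ∃ α₀ < α, ∃ β₀ < β, I 1 α₀ β₀ {A.nnf}}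

theorem Theory.mono {α α' β β' : Ordinal.{0}} (hα : α ≤ α') (hβ : β ≤ β') :
    (Theory α β : Set (Form L)) ⊆ Theory α' β' := by
  rintro A ⟨h, a, ha, b, hb, d⟩
  exact ⟨h, a, ha.trans_le hα, b, hb.trans_le hβ, d⟩

/-- The initial sequents of the calculus `Der`. The rule `trIntro` of `I` is among them, since its
premise has nothing to do with the context. -/
inductive IsAxiom (α β : Ordinal.{0}) (Γ : Finset (Form L)) : Prop
  | eq {s t} (h : eq s t ∈ Γ) (hv : s.value = t.value)
  | ne {s t} (h : neg (eq s t) ∈ Γ) (hv : s.value ≠ t.value)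
  | tr {s t} (h : tr s ∈ Γ) (h' : neg (tr t) ∈ Γ) (hv : t.value = s.value)
  | prov {t} (A : Form L) (h : tr t ∈ Γ) (hA : A ∈ Theory α β) (ht : t.value = A.code)
  | comp {s t} (A : Form L) (hA : A.IsSentence) (h : tr s ∈ Γ) (h' : tr t ∈ Γ)
      (hs : s.value = A.code) (ht : t.value = (neg A).code)

/-- `Der α k β Γ`: the calculus `I` at the fixed level `α`, with cuts of rank below `k` and with
the logical rules stated uniformly for formulas of conjunctive and of disjunctive type. Principal
formulas are kept in the premises, so that contraction is built in. -/
inductive Der (α : Ordinal.{0}) (k : ℕ) : Ordinal.{0} → Finset (Form L) → Prop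
  | ax {β Γ} (hΓ : IsSequent Γ) (h : IsAxiom α β Γ) : Der α k β Γ
  | conj {β Γ C F} (hC : Conj C F) (h : C ∈ Γ) (b : ℕ → Ordinal.{0}) (hb : ∀ n, b n < β)
      (d : ∀ n, Der α k (b n) (insert (F n) Γ)) : Der α k β Γ
  | disj {β β₀ Γ C F} (hC : Disj C F) (h : C ∈ Γ) (n : ℕ) (hb : β₀ < β)
      (d : Der α k β₀ (insert (F n) Γ)) : Der α k β Γ
  | cut {β β₀ β₁ Γ} (A : Form L) (hA : A.IsSentence) (hk : A.co < k) (h₀ : β₀ < β) (h₁ : β₁ < β)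
      (d₀ : Der α k β₀ (insert (A.nnfSigned true) Γ))
      (d₁ : Der α k β₁ (insert (A.nnfSigned false) Γ)) : Der α k β Γ
  | cons {β β₀ Γ} (n : ℕ) (hb : β₀ < β) (d₀ : Der α k β₀ (insert (tr (num n)) Γ))
      (d₁ : Der α k β₀ (insert (tr (dNeg (num n))) Γ)) : Der α k β Γ
  | norm {β β₀ Γ} (n : ℕ) (hb : β₀ < β) (hn : n ∉ sentenceCodes L)
      (d : Der α k β₀ (insert (tr (num n)) Γ)) : Der α k β Γ

variable {α α' β β' γ : Ordinal.{0}} {k k' : ℕ} {Γ Δ : Finset (Form L)}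

/-- Only the literals of a sequent matter for its being initial. -/
theorem IsAxiom.mono (h : IsAxiom α β Δ) (hα : α ≤ α') (hβ : β ≤ β')
    (hs : ∀ B ∈ Δ, B.co = 0 → B ∈ Γ) : IsAxiom α' β' Γ := by
  cases h with
  | eq h hv => exact .eq (hs _ h rfl) hv
  | ne h hv => exact .ne (hs _ h rfl) hv
  | tr h h' hv => exact .tr (hs _ h rfl) (hs _ h' rfl) hv
  | prov A h hA ht => exact .prov A (hs _ h rfl) (Theory.mono hα hβ hA) ht
  | comp A hA h h' h1 h2 => exact .comp A hA (hs _ h rfl) (hs _ h' rfl) h1 h2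

namespace Der

theorem isSequent (d : Der α k β Γ) : IsSequent Γ := by
  induction d with
  | ax hΓ => exact hΓ
  | conj _ _ _ _ _ ih => exact (ih 0).mono (Finset.subset_insert _ _)
  | disj _ _ _ _ _ ih => exact ih.mono (Finset.subset_insert _ _)
  | cut _ _ _ _ _ _ _ ih => exact ih.mono (Finset.subset_insert _ _)
  | cons _ _ _ _ ih => exact ih.mono (Finset.subset_insert _ _)
  | norm _ _ _ _ ih => exact ih.mono (Finset.subset_insert _ _)

theorem weaken (d : Der α k β Δ) (hα : α ≤ α') (hk : k ≤ k') (hβ : β ≤ β') (hs : Δ ⊆ Γ)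
    (hΓ : IsSequent Γ) : Der α' k' β' Γ := by
  induction d generalizing β' Γ with
  | ax _ h => exact .ax hΓ (h.mono hα hβ fun B hB _ => hs hB)
  | conj hC h b hb d ih =>
    exact .conj hC (hs h) b (fun n => (hb n).trans_le hβ) fun n =>
      ih n le_rfl (Finset.insert_subset_insert _ hs)
        (isSequent_insert.2 ⟨hC.good (hΓ _ (hs h)) n, hΓ⟩)
  | disj hC h n hb d ih =>
    exact .disj hC (hs h) n (hb.trans_le hβ) (ih le_rfl (Finset.insert_subset_insert _ hs)
        (isSequent_insert.2 ⟨hC.good (hΓ _ (hs h)) n, hΓ⟩))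
  | cut A hA hk' h₀ h₁ d₀ d₁ ih₀ ih₁ =>
    exact .cut A hA (hk'.trans_le hk) (h₀.trans_le hβ) (h₁.trans_le hβ)
      (ih₀ le_rfl (Finset.insert_subset_insert _ hs)
        (isSequent_insert.2 ⟨⟨hA.nnfSigned _, isNNF_nnfSigned _ _⟩, hΓ⟩))
      (ih₁ le_rfl (Finset.insert_subset_insert _ hs)
        (isSequent_insert.2 ⟨⟨hA.nnfSigned _, isNNF_nnfSigned _ _⟩, hΓ⟩))
  | cons n hb d₀ d₁ ih₀ ih₁ =>
    exact .cons n (hb.trans_le hβ)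
      (ih₀ le_rfl (Finset.insert_subset_insert _ hs) (isSequent_insert_tr (closed_num n) hΓ))
      (ih₁ le_rfl (Finset.insert_subset_insert _ hs)
        (isSequent_insert_tr (closed_dNeg_num n) hΓ))
  | norm n hb hn d ih =>
    exact .norm n (hb.trans_le hβ) hn
      (ih le_rfl (Finset.insert_subset_insert _ hs) (isSequent_insert_tr (closed_num n) hΓ))

theorem mono (d : Der α k β Γ) (hβ : β ≤ β') : Der α k β' Γ :=
  d.weaken le_rfl le_rfl hβ subset_rfl d.isSequent

/-- Removal of a formula `C` from a derivation. All rules in which `C` is not principal pass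
unchanged, so only initial sequents and inferences with principal formula `C` have to be treated;
`Θ` is a part of the context that their treatment may use. -/
theorem remove {C : Form L} {Θ : Finset (Form L)} {f : Ordinal.{0} → Ordinal.{0}}
    (hf : StrictMono f)
    (hax : ∀ β Δ Γ, Θ ⊆ Γ → IsSequent Γ → Δ ⊆ insert C Γ → IsAxiom α β Δ → Der α k (f β) Γ)
    (hconj : ∀ F, Conj C F → ∀ β Γ (b : ℕ → Ordinal.{0}), Θ ⊆ Γ → (∀ n, b n < β) →
      (∀ n, Der α k (f (b n)) (insert (F n) Γ)) → Der α k (f β) Γ)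
    (hdisj : ∀ F, Disj C F → ∀ β Γ β₀ n, Θ ⊆ Γ → β₀ < β →
      Der α k (f β₀) (insert (F n) Γ) → Der α k (f β) Γ)
    (d : Der α k β Δ) (h₀ : Θ ⊆ Γ) (hs : Δ ⊆ insert C Γ) (hΓ : IsSequent Γ) :
    Der α k (f β) Γ := by
  have hins : ∀ {A : Form L} {Δ Γ : Finset (Form L)}, Δ ⊆ insert C Γ →
      insert A Δ ⊆ insert C (insert A Γ) := fun {A Δ Γ} h => by
    rw [Finset.insert_comm]
    exact Finset.insert_subset_insert _ h
  have hsub : ∀ {A : Form L} {Γ : Finset (Form L)}, Θ ⊆ Γ → Θ ⊆ insert A Γ :=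
    fun h => h.trans (Finset.subset_insert _ _)
  induction d generalizing Γ with
  | ax _ h => exact hax _ _ _ h₀ hΓ hs h
  | @conj β Δ C' F hC h b hb d ih =>
    have ih' := fun n => ih n (hsub h₀) (hins hs)
      (isSequent_insert.2 ⟨(isSequent_insert.1 (d n).isSequent).1, hΓ⟩)
    rcases Finset.mem_insert.1 (hs h) with rfl | h
    · exact hconj _ hC _ _ b h₀ hb ih'
    · exact .conj hC h _ (fun n => hf (hb n)) ih'
  | @disj β β₀ Δ C' F hC h n hb d ih =>
    have ih' := ih (hsub h₀) (hins hs)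
      (isSequent_insert.2 ⟨(isSequent_insert.1 d.isSequent).1, hΓ⟩)
    rcases Finset.mem_insert.1 (hs h) with rfl | h
    · exact hdisj _ hC _ _ _ n h₀ hb ih'
    · exact .disj hC h n (hf hb) ih'
  | cut A hA hk h₀' h₁' d₀ d₁ ih₀ ih₁ =>
    exact .cut A hA hk (hf h₀') (hf h₁')
      (ih₀ (hsub h₀) (hins hs) (isSequent_insert.2 ⟨(isSequent_insert.1 d₀.isSequent).1, hΓ⟩))
      (ih₁ (hsub h₀) (hins hs) (isSequent_insert.2 ⟨(isSequent_insert.1 d₁.isSequent).1, hΓ⟩))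
  | cons n hb d₀ d₁ ih₀ ih₁ =>
    exact .cons n (hf hb)
      (ih₀ (hsub h₀) (hins hs) (isSequent_insert_tr (closed_num n) hΓ))
      (ih₁ (hsub h₀) (hins hs) (isSequent_insert_tr (closed_dNeg_num n) hΓ))
  | norm n hb hn d ih =>
    exact .norm n (hf hb) hn
      (ih (hsub h₀) (hins hs) (isSequent_insert_tr (closed_num n) hΓ))

theorem _root_.VFM.IsAxiom.of_insert {C : Form L} (h : IsAxiom α β Δ) (hs : Δ ⊆ insert C Γ)
    (hC : C.co ≠ 0) : IsAxiom α β Γ :=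
  h.mono le_rfl le_rfl fun B hB h0 =>
    Finset.mem_of_mem_insert_of_ne (hs hB) (by rintro rfl; exact hC h0)

theorem conj_inversion {C : Form L} {F : ℕ → Form L} (hC : Conj C F) (n : ℕ)
    (d : Der α k β (insert C Γ)) : Der α k β (insert (F n) Γ) := by
  have hs := isSequent_insert.1 d.isSequent
  refine remove (f := id) (C := C) (Θ := {F n}) strictMono_id ?_ ?_ ?_ d (by simp)
    (Finset.insert_subset_insert _ (Finset.subset_insert _ _))
    (isSequent_insert.2 ⟨hC.good hs.1 n, hs.2⟩)
  · intro β Δ Γ _ hΓ hs h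
    exact .ax hΓ (h.of_insert hs hC.co_ne_zero)
  · intro G hG β Γ b h₀ hb d
    obtain rfl := hC.unique hG
    have := d n
    rw [Finset.insert_eq_of_mem (h₀ (by simp))] at this
    exact this.mono (hb n).le
  · intro G hG
    exact (hC.not_disj hG).elim

theorem cut_signed (A : Form L) (b : Bool) (hA : A.IsSentence) (hk : A.co < k)
    {β₀ β₁ : Ordinal.{0}} (h₀ : β₀ < β) (h₁ : β₁ < β)
    (d₀ : Der α k β₀ (insert (A.nnfSigned b) Γ))
    (d₁ : Der α k β₁ (insert (A.nnfSigned !b) Γ)) : Der α k β Γ := by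
  cases b
  · exact .cut A hA hk h₁ h₀ d₁ d₀
  · exact .cut A hA hk h₀ h₁ d₀ d₁

/-- Reduction of a cut on a compound formula to cuts on its instances `B n`. -/
theorem reduce_compound {C D : Form L} {F G B : ℕ → Form L} {b : Bool} (hC : Conj C F)
    (hD : Disj D G) (hF : ∀ n, F n = (B n).nnfSigned b) (hG : ∀ n, G n = (B n).nnfSigned !b)
    (hB : ∀ n, (B n).IsSentence) (hk : ∀ n, (B n).co < k)
    (d : Der α k β (insert C Γ)) (d' : Der α k γ (insert D Γ)) : Der α k (β + γ) Γ := by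
  have hΓ := (isSequent_insert.1 d.isSequent).2
  refine remove (f := (β + ·)) (C := D) (Θ := Γ) (fun _ _ h => by simpa using h)
    ?_ ?_ ?_ d' subset_rfl subset_rfl hΓ
  · intro γ Δ Γ' _ hΓ' hs h
    exact .ax hΓ' ((h.of_insert hs hD.co_ne_zero).mono le_rfl le_add_self fun _ h _ => h)
  · intro F' hF'
    exact (hF'.not_disj hD).elim
  · intro G' hG' γ Γ' γ₀ n hΓ' hγ d'
    obtain rfl := hD.unique hG'
    rw [hG] at d'
    have hd := conj_inversion hC n d
    rw [hF] at hd
    refine cut_signed (B n) b (hB n) (hk n) ?_ ?_ (hd.weaken le_rfl le_rfl le_rfl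
      (Finset.insert_subset_insert _ hΓ') ?_) d'
    · exact lt_add_of_pos_right _ (bot_le.trans_lt hγ)
    · simpa using hγ
    · exact isSequent_insert.2 ⟨(isSequent_insert.1 hd.isSequent).1,
        (isSequent_insert.1 d'.isSequent).2⟩

/-- A formula that is not principal in logical inferences and does not contribute to initial
sequents may be dropped. -/
theorem drop_false {C : Form L} (hC : ∀ F, ¬ Conj C F) (hD : ∀ F, ¬ Disj C F)
    (hax : ∀ β Δ Γ, Δ ⊆ insert C Γ → IsAxiom α β Δ → IsAxiom α β Γ)
    (d : Der α k β (insert C Γ)) : Der α k β Γ := by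
  refine remove (f := id) (C := C) (Θ := ∅) strictMono_id ?_ (fun F h => (hC F h).elim)
    (fun F h => (hD F h).elim) d (by simp) subset_rfl (isSequent_insert.1 d.isSequent).2
  intro β Δ Γ _ hΓ hs h
  exact .ax hΓ (hax _ _ _ hs h)

theorem drop_false_eq {s t : Term L} (h : s.value ≠ t.value)
    (d : Der α k β (insert (eq s t) Γ)) : Der α k β Γ := by
  refine d.drop_false (fun F => by rintro ⟨⟩) (fun F => by rintro ⟨⟩) ?_
  intro β Δ Γ hs h'
  cases h' with
  | eq h' hv =>
    rcases Finset.mem_insert.1 (hs h') with e | h'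
    · cases e
      exact (h hv).elim
    · exact .eq h' hv
  | ne h' hv => exact .ne (by simpa using hs h') hv
  | tr h h' hv => exact .tr (by simpa using hs h) (by simpa using hs h') hv
  | prov A h hA ht => exact .prov A (by simpa using hs h) hA ht
  | comp A hA h h' h1 h2 => exact .comp A hA (by simpa using hs h) (by simpa using hs h') h1 h2

theorem drop_false_ne {s t : Term L} (h : s.value = t.value)
    (d : Der α k β (insert (neg (eq s t)) Γ)) : Der α k β Γ := by
  refine d.drop_false (fun F => by rintro ⟨⟩) (fun F => by rintro ⟨⟩) ?_
  intro β Δ Γ hs h'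
  cases h' with
  | ne h' hv =>
    rcases Finset.mem_insert.1 (hs h') with e | h'
    · cases e
      exact (hv h).elim
    · exact .ne h' hv
  | eq h' hv => exact .eq (by simpa using hs h') hv
  | tr h h' hv => exact .tr (by simpa using hs h) (by simpa using hs h') hv
  | prov A h hA ht => exact .prov A (by simpa using hs h) hA ht
  | comp A hA h h' h1 h2 => exact .comp A hA (by simpa using hs h) (by simpa using hs h') h1 h2

/-- The axioms and rules for positive occurrences of the truth predicate only depend on the values
of terms. -/
theorem tr_congr {s t : Term L} (hs : tr s ∈ Γ) (h : s.value = t.value)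
    (d : Der α k β (insert (tr t) Γ)) : Der α k β Γ := by
  refine remove (f := id) (C := tr t) (Θ := {tr s}) strictMono_id ?_
    (fun F => by rintro ⟨⟩) (fun F => by rintro ⟨⟩) d (by simpa) subset_rfl
    (isSequent_insert.1 d.isSequent).2
  intro β Δ Γ h₀ hΓ hsub h'
  have key : ∀ {u : Term L}, tr u ∈ Δ → ∃ u' : Term L, tr u' ∈ Γ ∧ u'.value = u.value := by
    intro u hu
    rcases Finset.mem_insert.1 (hsub hu) with e | hu
    · cases e
      exact ⟨s, h₀ (by simp), h⟩
    · exact ⟨u, hu, rfl⟩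
  refine .ax hΓ ?_
  cases h' with
  | eq h' hv => exact .eq (by simpa using hsub h') hv
  | ne h' hv => exact .ne (by simpa using hsub h') hv
  | tr h h' hv =>
    obtain ⟨u, hu, e⟩ := key h
    exact .tr hu (by simpa using hsub h') (hv.trans e.symm)
  | prov A h hA ht =>
    obtain ⟨u, hu, e⟩ := key h
    exact .prov A hu hA (e.trans ht)
  | comp A hA h h' h1 h2 =>
    obtain ⟨u, hu, e⟩ := key h
    obtain ⟨u', hu', e'⟩ := key h'
    exact .comp A hA hu hu' (e.trans h1) (e'.trans h2)

/-- Cuts on `Tr(t)` can be eliminated because `¬ Tr(t)` is principal only in initial sequents that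
also contain `Tr(s)` for some `s` with the value of `t`. -/
theorem reduce_tr {t : Term L} (d : Der α k β (insert (tr t) Γ))
    (d' : Der α k γ (insert (neg (tr t)) Γ)) : Der α k (β + γ) Γ := by
  have ht := isSequent_insert.1 d.isSequent
  refine remove (f := (β + ·)) (C := neg (tr t)) (Θ := Γ) (fun _ _ h => by simpa using h)
    ?_ (fun F => by rintro ⟨⟩) (fun F => by rintro ⟨⟩) d' subset_rfl subset_rfl ht.2
  intro γ Δ Γ' hΓ hΓ' hs h
  have hγ : γ ≤ β + γ := le_add_self
  cases h with
  | eq h hv => exact .ax hΓ' (.eq (by simpa using hs h) hv)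
  | ne h hv => exact .ax hΓ' (.ne (by simpa using hs h) hv)
  | @tr s u h h' hv =>
    have h : tr s ∈ Γ' := by simpa using hs h
    rcases Finset.mem_insert.1 (hs h') with e | h'
    · cases e
      exact tr_congr h hv.symm (d.weaken le_rfl le_rfl le_self_add
        (Finset.insert_subset_insert _ hΓ) (isSequent_insert.2 ⟨ht.1, hΓ'⟩))
    · exact .ax hΓ' (.tr h h' hv)
  | prov A h hA ht => exact .ax hΓ' (.prov A (by simpa using hs h) (Theory.mono le_rfl hγ hA) ht)
  | comp A hA h h' h1 h2 =>
    exact .ax hΓ' (.comp A hA (by simpa using hs h) (by simpa using hs h') h1 h2)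

/-- Elimination of a single cut whose rank is at most `k`, at the price of cuts of rank below `k`.
The bound on the height is symmetric since a negation swaps the roles of the two premises. -/
theorem reduce (A : Form L) (hA : A.IsSentence) (hk : A.co ≤ k)
    (d : Der α k β (insert (A.nnfSigned true) Γ))
    (d' : Der α k γ (insert (A.nnfSigned false) Γ)) :
    Der α k (max β γ + max β γ) Γ := by
  have h1 : β + γ ≤ max β γ + max β γ := add_le_add (le_max_left _ _) (le_max_right _ _)
  have h2 : γ + β ≤ max β γ + max β γ := add_le_add (le_max_right _ _) (le_max_left _ _)
  induction A generalizing β γ with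
  | eq s t =>
    by_cases h : s.value = t.value
    · exact (drop_false_ne h d').mono (le_self_add.trans h2)
    · exact (drop_false_eq h d).mono (le_self_add.trans h1)
  | tr t => exact (reduce_tr d d').mono h1
  | neg A ih =>
    have := ih hA hk d' d
    rw [max_comm] at this
    exact this h2 h1
  | and A B =>
    rw [isSentence_and] at hA
    have hk' : max A.co B.co < k := hk
    rw [max_lt_iff] at hk'
    refine (reduce_compound (B := fun n => if n = 0 then A else B) (b := true) (.and _ _) (.or _ _)
      ?_ ?_ ?_ ?_ d d').mono h1 <;> intro n <;> by_cases e : n = 0 <;> simp [e, hA, hk']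
  | or A B =>
    rw [isSentence_or] at hA
    have hk' : max A.co B.co < k := hk
    rw [max_lt_iff] at hk'
    refine (reduce_compound (B := fun n => if n = 0 then A else B) (b := false) (.and _ _) (.or _ _)
      ?_ ?_ ?_ ?_ d' d).mono h2 <;> intro n <;> by_cases e : n = 0 <;> simp [e, hA, hk']
  | all v A =>
    have hk' : A.co < k := hk
    refine (reduce_compound (B := fun n => A.subst v (num n)) (b := true) (.all _ _) (.ex _ _)
      ?_ ?_ ?_ ?_ d d').mono h1 <;> intro n
    · rw [nnfSigned_subst]
    · rw [nnfSigned_subst]; rfl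
    · exact (isSentence_all_iff (closed_num n)).1 hA
    · rwa [co_subst]
  | ex v A =>
    have hk' : A.co < k := hk
    refine (reduce_compound (B := fun n => A.subst v (num n)) (b := false) (.all _ _) (.ex _ _)
      ?_ ?_ ?_ ?_ d' d).mono h2 <;> intro n
    · rw [nnfSigned_subst]
    · rw [nnfSigned_subst]; rfl
    · exact (isSentence_all_iff (closed_num n)).1 hA
    · rwa [co_subst]

theorem _root_.VFM.omega0_opow_strictMono : StrictMono (fun b : Ordinal.{0} => ω ^ b) :=
  fun _ _ h => (Ordinal.opow_lt_opow_iff_right Ordinal.one_lt_omega0).2 h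

/-- Lowering of the cut rank by one raises the height exponentially. -/
theorem elim_rank (d : Der α (k + 1) β Γ) : Der α k (ω ^ β) Γ := by
  have hm := omega0_opow_strictMono
  induction d with
  | ax hΓ h => exact .ax hΓ (h.mono le_rfl hm.le_apply fun _ h _ => h)
  | conj hC h b hb d ih => exact .conj hC h _ (fun n => hm (hb n)) ih
  | disj hC h n hb d ih => exact .disj hC h n (hm hb) ih
  | cons n hb d₀ d₁ ih₀ ih₁ => exact .cons n (hm hb) ih₀ ih₁
  | norm n hb hn d ih => exact .norm n (hm hb) hn ih
  | cut A hA hk h₀ h₁ d₀ d₁ ih₀ ih₁ =>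
    have hmax := max_lt (hm h₀) (hm h₁)
    exact (reduce A hA (Nat.lt_succ_iff.1 hk) ih₀ ih₁).mono
      (Ordinal.isPrincipal_add_omega0_opow _ hmax hmax).le

theorem _root_.VFM.opow_lt_epsilon {δ : Ordinal.{0}} (h : β < Ordinal.epsilon δ) :
    ω ^ β < Ordinal.epsilon δ := by
  rw [← Ordinal.omega0_opow_epsilon δ]
  exact omega0_opow_strictMono h

theorem cut_elimination {δ : Ordinal.{0}} (d : Der α k β Γ) (hβ : β < Ordinal.epsilon δ) :
    ∃ β' < Ordinal.epsilon δ, Der α 0 β' Γ := by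
  induction k generalizing β with
  | zero => exact ⟨β, hβ, d⟩
  | succ k ih => exact ih d.elim_rank (opow_lt_epsilon hβ)

end Der

/-! ### Translations between the two calculi -/

theorem I.isSequent {i : Fin 2} (d : I i α β Γ) : IsSequent Γ := by
  induction d with
  | ax1 h | ax2 h | ax3 h | comp _ h => exact h
  | trIntro _ _ _ h => exact h
  | or _ _ ih =>
    simp only [isSequent_insert, isSentence_or, IsNNF] at ih ⊢
    tauto
  | and _ _ _ ih₀ ih₁ =>
    simp only [isSequent_insert, isSentence_and, IsNNF] at ih₀ ih₁ ⊢
    tauto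
  | ex n _ _ ih =>
    rw [isSequent_insert] at ih ⊢
    obtain ⟨⟨h1, h2⟩, h3⟩ := ih
    rw [isNNF_subst] at h2
    exact ⟨⟨(isSentence_ex_iff (closed_num n)).2 h1, h2⟩, h3⟩
  | all b _ _ ih =>
    have ih := ih 0
    rw [isSequent_insert] at ih ⊢
    obtain ⟨⟨h1, h2⟩, h3⟩ := ih
    rw [isNNF_subst] at h2
    exact ⟨⟨(isSentence_all_iff (closed_num 0)).2 h1, h2⟩, h3⟩
  | cons _ _ _ _ ih => exact (isSequent_insert.1 ih).2
  | norm _ _ _ _ ih => exact (isSequent_insert.1 ih).2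

theorem I.to_one {i : Fin 2} (d : I i α β Γ) : I 1 α β Γ := by
  induction d with
  | ax1 h h' => exact .ax1 h h'
  | ax2 h h' => exact .ax2 h h'
  | ax3 h h' => exact .ax3 h h'
  | or h _ ih => exact .or h ih
  | and h _ _ ih ih' => exact .and h ih ih'
  | ex n h _ ih => exact .ex n h ih
  | all b hb _ ih => exact .all b hb ih
  | trIntro A hα hβ hΓ hA ht _ ih => exact .trIntro A hα hβ hΓ hA ht ih
  | comp A h h1 h2 h3 => exact .comp A h h1 h2 h3
  | cons n h d d' => exact .cons n h d d'
  | norm n h h' d => exact .norm n h h' d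

/-- Heights are doubled since a disjunction is introduced by two steps of `Der`. -/
theorem I.der {i : Fin 2} (d : I i α β Γ) : Der α 0 (2 * β) Γ := by
  have hm : StrictMono (fun b : Ordinal.{0} => 2 * b) :=
    fun _ _ h => (mul_lt_mul_iff_right₀ two_pos).2 h
  have hle : ∀ b : Ordinal.{0}, b ≤ 2 * b := fun b => hm.le_apply
  have up : ∀ {α β : Ordinal.{0}} {A C : Form L} {Γ : Finset (Form L)},
      IsSequent (insert C Γ) → Der α 0 β (insert A Γ) →
      Der α 0 β (insert A (insert C Γ)) := fun hC d =>
    d.weaken le_rfl le_rfl le_rfl (Finset.insert_subset_insert _ (Finset.subset_insert _ _))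
      (isSequent_insert.2 ⟨(isSequent_insert.1 d.isSequent).1, hC⟩)
  induction d with
  | ax1 h h' => exact .ax h (.eq (by simp) h')
  | ax2 h h' => exact .ax h (.ne (by simp) h')
  | ax3 h h' => exact .ax h (.tr (by simp) (by simp) h')
  | comp A h h1 h2 h3 => exact .ax h (.comp A h1 (by simp) (by simp) h2 h3)
  | trIntro A hα hβ hΓ hA ht d =>
    exact .ax hΓ (.prov A (by simp) ⟨hA, _, hα, _, hβ.trans_le (hle _), d.to_one⟩ ht)
  | @or _ _ β β₀ Γ A B h d ih =>
    have hs := (d.or h).isSequent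
    have hA := (isSequent_insert.1 ih.isSequent).1
    have hB := (isSequent_insert.1 (isSequent_insert.1 ih.isSequent).2).1
    have key : 2 * β₀ + 1 < 2 * β :=
      calc 2 * β₀ + 1 < 2 * β₀ + 2 := by simp
        _ = 2 * (β₀ + 1) := by rw [mul_add, mul_one]
        _ ≤ 2 * β := by gcongr; exact Order.add_one_le_of_lt h
    refine .disj (.or A B) (by simp) 1 key (.disj (.or A B) (by simp) 0 (by simp : 2 * β₀ < _) ?_)
    simp only [one_ne_zero, if_true, if_false]
    refine ih.weaken le_rfl le_rfl le_rfl ?_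
      (isSequent_insert.2 ⟨hA, isSequent_insert.2 ⟨hB, hs⟩⟩)
    exact Finset.insert_subset_insert _ (Finset.insert_subset_insert _ (Finset.subset_insert _ _))
  | @and _ _ _ _ _ A B h d d' ih ih' =>
    refine .conj (.and A B) (by simp) (fun _ => _) (fun _ => hm h) fun n => ?_
    by_cases e : n = 0 <;> simp only [e, if_true, if_false]
    exacts [up (d.and h d').isSequent ih, up (d.and h d').isSequent ih']
  | ex n h d ih => exact .disj (.ex _ _) (by simp) n (hm h) (up (d.ex n h).isSequent ih)
  | all b hb d ih =>
    exact .conj (.all _ _) (by simp) _ (fun n => hm (hb n)) fun n =>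
      up (I.all b hb d).isSequent (ih n)
  | cons n h _ _ ih ih' => exact .cons n (hm h) ih ih'
  | norm n h h' _ ih => exact .norm n (hm h) h' ih

/-- Weakening is built in, since `or` of `I` has both disjuncts in its premise. -/
theorem Der.to_I (d : Der α 0 β Δ) (hβ : β ≤ β') (hs : Δ ⊆ Γ) (hΓ : IsSequent Γ) :
    I 1 α β' Γ := by
  induction d generalizing β' Γ with
  | ax _ h =>
    cases h with
    | eq h hv =>
      have := hs h
      rw [← Finset.insert_eq_of_mem this] at hΓ ⊢
      exact .ax1 hΓ hv
    | ne h hv =>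
      have := hs h
      rw [← Finset.insert_eq_of_mem this] at hΓ ⊢
      exact .ax2 hΓ hv
    | tr h h' hv =>
      have h1 := hs h
      have h2 := hs h'
      rw [← Finset.insert_eq_of_mem h1, ← Finset.insert_eq_of_mem h2] at hΓ ⊢
      exact .ax3 hΓ hv
    | prov A h hA ht =>
      have := hs h
      obtain ⟨hA, a, ha, b, hb, d⟩ := hA
      rw [← Finset.insert_eq_of_mem this] at hΓ ⊢
      exact .trIntro A ha (hb.trans_le hβ) hΓ hA ht d
    | comp A hA h h' h1 h2 =>
      have h3 := hs h
      have h4 := hs h'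
      rw [← Finset.insert_eq_of_mem h3, ← Finset.insert_eq_of_mem h4] at hΓ ⊢
      exact .comp A hΓ hA h1 h2
  | conj hC h b hb d ih =>
    have hg := hC.good (hΓ _ (hs h))
    have hi := fun n => (isSequent_insert.2 ⟨hg n, hΓ⟩)
    rw [← Finset.insert_eq_of_mem (hs h)]
    cases hC with
    | and A B =>
      refine .and ((max_lt (hb 0) (hb 1)).trans_le hβ)
        (ih 0 (le_max_left _ _) (Finset.insert_subset_insert _ hs) (hi 0))
        (ih 1 (le_max_right _ _) (Finset.insert_subset_insert _ hs) (hi 1))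
    | all v A =>
      exact .all b (fun n => (hb n).trans_le hβ) fun n =>
        ih n le_rfl (Finset.insert_subset_insert _ hs) (hi n)
  | disj hC h n hb d ih =>
    have hg := hC.good (hΓ _ (hs h))
    rw [← Finset.insert_eq_of_mem (hs h)]
    cases hC with
    | or A B =>
      refine .or (hb.trans_le hβ)
        (ih le_rfl ?_ (isSequent_insert.2 ⟨hg 0, isSequent_insert.2 ⟨hg 1, hΓ⟩⟩))
      refine Finset.insert_subset ?_ (hs.trans ((Finset.subset_insert _ _).trans
        (Finset.subset_insert _ _)))
      by_cases e : n = 0 <;> simp [e]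
    | ex v A =>
      exact .ex n (hb.trans_le hβ)
        (ih le_rfl (Finset.insert_subset_insert _ hs) (isSequent_insert.2 ⟨hg n, hΓ⟩))
  | cut A hA hk => exact absurd hk (Nat.not_lt_zero _)
  | cons n hb d₀ d₁ ih₀ ih₁ =>
    exact .cons n (hb.trans_le hβ)
      (ih₀ le_rfl (Finset.insert_subset_insert _ hs) (isSequent_insert_tr (closed_num n) hΓ))
      (ih₁ le_rfl (Finset.insert_subset_insert _ hs)
        (isSequent_insert_tr (closed_dNeg_num n) hΓ))
  | norm n hb hn d ih =>
    exact .norm n (hb.trans_le hβ) hn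
      (ih le_rfl (Finset.insert_subset_insert _ hs) (isSequent_insert_tr (closed_num n) hΓ))

/-- Cut elimination, stated for `I`: heights below an epsilon number stay below it. -/
theorem Der.I_epsilon {δ : Ordinal.{0}} (d : Der α k β Γ) (hβ : β < Ordinal.epsilon δ) :
    I 1 α (Ordinal.epsilon δ) Γ := by
  obtain ⟨β', h, d'⟩ := d.cut_elimination hβ
  exact d'.to_I h.le subset_rfl d.isSequent

end Calculus

/-! ### Maximal consistent interpretations of the truth predicate -/

section Semantics

open Form Term

variable {α β : Ordinal.{0}} {k : ℕ} {Γ : Finset (Form L)}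

/-- `X` is the set of Gödel numbers of a set of sentences that contains exactly one of `A`, `¬ A`
for every sentence `A`, and that contains the theory `Theory α β`. Closure of `X` under any rule of
inference is not demanded. -/
structure IsModel (L : Signature) (α β : Ordinal.{0}) (X : Set ℕ) : Prop where
  subset : X ⊆ sentenceCodes L
  neg_iff : ∀ A : Form L, A.IsSentence → ((neg A).code ∈ X ↔ A.code ∉ X)
  theory : ∀ A : Form L, A ∈ Theory α β → A.code ∈ X

theorem IsModel.mono {α' β' : Ordinal.{0}} {X : Set ℕ} (h : IsModel L α' β' X) (hα : α ≤ α')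
    (hβ : β ≤ β') : IsModel L α β X :=
  ⟨h.subset, h.neg_iff, fun A hA => h.theory A (Theory.mono hα hβ hA)⟩

theorem sat_subst_num {X : Set ℕ} {A : Form L} {v n : ℕ} {e : ℕ → ℕ} :
    (A.subst v (num n)).Sat X e ↔ A.Sat X (Function.update e v n) := by
  rw [sat_subst (closed_num n), value_num]

theorem Conj.sat_iff {X : Set ℕ} {e : ℕ → ℕ} {C : Form L} {F} (h : Conj C F) :
    C.Sat X e ↔ ∀ n, (F n).Sat X e := by
  cases h with
  | and A B =>
    refine ⟨fun h n => ?_, fun h => ⟨h 0, h 1⟩⟩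
    by_cases e : n = 0 <;> simp only [e, if_true, if_false]
    exacts [h.1, h.2]
  | all v A => simp only [sat_subst_num, Sat]

theorem Disj.sat_of {X : Set ℕ} {e : ℕ → ℕ} {C : Form L} {F} (h : Disj C F) (n : ℕ)
    (hn : (F n).Sat X e) : C.Sat X e := by
  cases h with
  | or A B =>
    by_cases e : n = 0 <;> simp only [e, if_true, if_false] at hn
    exacts [Or.inl hn, Or.inr hn]
  | ex v A => exact ⟨n, sat_subst_num.1 hn⟩

/-- Heights matter here because `X` is only required to contain the sentences with derivations of
height below that of `d`. -/
theorem Der.sound {X : Set ℕ} (d : Der α k β Γ) (hX : IsModel L α β X) :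
    ∃ A ∈ Γ, A.Sat X (fun _ => 0) := by
  have hlt : ∀ {β β₀ : Ordinal.{0}}, IsModel L α β X → β₀ < β → IsModel L α β₀ X :=
    fun h hb => h.mono le_rfl hb.le
  induction d with
  | ax hΓ h =>
    cases h with
    | eq h hv => exact ⟨_, h, hv⟩
    | ne h hv => exact ⟨_, h, hv⟩
    | @tr s t h h' hv =>
      by_cases hs : s.value ∈ X
      · exact ⟨_, h, hs⟩
      · rw [← hv] at hs
        exact ⟨_, h', hs⟩
    | @prov t A h hA ht =>
      refine ⟨_, h, ?_⟩
      have := hX.theory A hA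
      rw [← ht] at this
      exact this
    | @comp s t A hA h h' h1 h2 =>
      have := hX.neg_iff A hA
      rw [← h1, ← h2] at this
      by_cases hs : s.value ∈ X
      · exact ⟨_, h, hs⟩
      · exact ⟨_, h', this.2 hs⟩
  | @conj β Γ C F hC h b hb d ih =>
    by_contra! hcon
    refine hcon C h (hC.sat_iff.2 fun n => ?_)
    obtain ⟨A, hA, hs⟩ := ih n (hlt hX (hb n))
    rcases Finset.mem_insert.1 hA with rfl | hA
    · exact hs
    · exact (hcon A hA hs).elim
  | disj hC h n hb d ih =>
    obtain ⟨A, hA, hs⟩ := ih (hlt hX hb)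
    rcases Finset.mem_insert.1 hA with rfl | hA
    · exact ⟨_, h, hC.sat_of n hs⟩
    · exact ⟨A, hA, hs⟩
  | cut A hA hk h₀ h₁ d₀ d₁ ih₀ ih₁ =>
    obtain ⟨B, hB, hs⟩ := ih₀ (hlt hX h₀)
    obtain ⟨B', hB', hs'⟩ := ih₁ (hlt hX h₁)
    rcases Finset.mem_insert.1 hB with rfl | hB
    · rcases Finset.mem_insert.1 hB' with rfl | hB'
      · exact absurd ((sat_nnfSigned _).1.1 hs) ((sat_nnfSigned _).2.1 hs')
      · exact ⟨B', hB', hs'⟩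
    · exact ⟨B, hB, hs⟩
  | cons n hb d₀ d₁ ih₀ ih₁ =>
    obtain ⟨B, hB, hs⟩ := ih₀ (hlt hX hb)
    obtain ⟨B', hB', hs'⟩ := ih₁ (hlt hX hb)
    rcases Finset.mem_insert.1 hB with rfl | hB
    · rcases Finset.mem_insert.1 hB' with rfl | hB'
      · have h1 : (num n : Term L).value ∈ X := hs
        have h2 : (dNeg (num n) : Term L).value ∈ X := hs'
        rw [value_num] at h1
        rw [value_dNeg_num] at h2
        obtain ⟨A, hA, rfl⟩ := hX.subset h1
        exact absurd h1 ((hX.neg_iff A hA).1 h2)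
      · exact ⟨B', hB', hs'⟩
    · exact ⟨B, hB, hs⟩
  | norm n hb hn d ih =>
    obtain ⟨B, hB, hs⟩ := ih (hlt hX hb)
    rcases Finset.mem_insert.1 hB with rfl | hB
    · have h1 : (num n : Term L).value ∈ X := hs
      rw [value_num] at h1
      exact absurd (hX.subset h1) hn
    · exact ⟨B, hB, hs⟩

/-- The truth value of a sentence under the following extension of a set `T` of sentences: `neg`
is interpreted by negation, and a sentence that is not a negation is true if it is in `T` or if
`T` does not contain its negation and the default value `p` is true. -/
def completion (T : Set (Form L)) (p : Prop) : Form L → Prop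
  | neg A => ¬ completion T p A
  | A => A ∈ T ∨ (neg A ∉ T ∧ p)

theorem completion_of_mem {T : Set (Form L)} (hT : ∀ A ∈ T, neg A ∉ T)
    (hneg : ∀ A, neg (neg A) ∈ T → A ∈ T) (p : Prop) (A : Form L) :
    (A ∈ T → completion T p A) ∧ (neg A ∈ T → ¬ completion T p A) := by
  have base : ∀ A, (A ∈ T → A ∈ T ∨ (neg A ∉ T ∧ p)) ∧
      (neg A ∈ T → ¬ (A ∈ T ∨ (neg A ∉ T ∧ p))) := fun A => by
    have := hT A
    tauto
  induction A with
  | neg A ih => exact ⟨ih.2, fun h => not_not.2 (ih.1 (hneg A h))⟩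
  | _ => exact base _

/-- A sentence that `T` leaves open has different truth values under the two completions. -/
theorem completion_true_iff {T : Set (Form L)} (hneg : ∀ A, A ∈ T → neg (neg A) ∈ T)
    {A : Form L} (h : A ∉ T) (h' : neg A ∉ T) :
    completion T True A ↔ ¬ completion T False A := by
  induction A with
  | neg A ih =>
    have := ih (fun hA => h' (hneg A hA)) h
    simp only [completion]
    tauto
  | _ => simp only [completion]; tauto

theorem mem_theory_neg_neg {A : Form L} : neg (neg A) ∈ Theory α β ↔ A ∈ Theory α β := Iff.rfl

theorem isModel_completion (hT : ∀ A : Form L, A ∈ Theory α β → neg A ∉ Theory α β) (p : Prop) :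
    IsModel L α β {n | ∃ A : Form L, A.IsSentence ∧ completion (Theory α β) p A ∧ A.code = n} where
  subset := fun n ⟨A, hA, _, h⟩ => ⟨A, hA, h⟩
  neg_iff := by
    intro A hA
    constructor
    · rintro ⟨B, hB, hc, h⟩ ⟨C, hC, hc', h'⟩
      obtain rfl := Form.code_injective h
      obtain rfl := Form.code_injective h'
      exact hc hc'
    · intro h
      exact ⟨neg A, hA, fun hc => h ⟨A, hA, hc, rfl⟩, rfl⟩
  theory := fun A hA =>
    ⟨A, hA.1, (completion_of_mem hT (fun _ => mem_theory_neg_neg.1) p A).1 hA, rfl⟩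

/-- By induction on the level: two contradictory members of the theory are derivable at a smaller
level, where they are both satisfied under a completion of the theory of that level. -/
theorem theory_consistent (A : Form L) (h : A ∈ Theory α β) : neg A ∉ Theory α β := by
  induction α using WellFoundedLT.induction generalizing β A with
  | ind α ih =>
    obtain ⟨hA, a, ha, b, hb, d⟩ := h
    rintro ⟨-, a', ha', b', hb', d'⟩
    have hX := isModel_completion (ih (max a a') (max_lt ha ha') (β := 2 * max b b')) True
    have h2 : ∀ {x y : Ordinal.{0}}, x ≤ y → 2 * x ≤ 2 * y := fun h => by gcongr
    obtain ⟨B, hB, hs⟩ := d.der.sound (hX.mono (le_max_left _ _) (h2 (le_max_left _ _)))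
    obtain ⟨B', hB', hs'⟩ := d'.der.sound (hX.mono (le_max_right _ _) (h2 (le_max_right _ _)))
    obtain rfl := Finset.mem_singleton.1 hB
    obtain rfl := Finset.mem_singleton.1 hB'
    exact (sat_nnfSigned _).2.1 hs' ((sat_nnfSigned _).1.1 hs)

theorem exists_isModel (L : Signature) (α β : Ordinal.{0}) : ∃ X, IsModel L α β X :=
  ⟨_, isModel_completion theory_consistent True⟩

/-- Inversion of truth: `Tr(t)` is derivable only if the sentence it is about is already in the
theory, since otherwise that sentence fails under one of the two completions. -/
theorem Der.exists_mem_theory {t : Term L} (d : Der α k β {tr t}) :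
    ∃ A : Form L, A ∈ Theory α β ∧ t.value = A.code := by
  have key : ∀ p : Prop, ∃ A : Form L, A.IsSentence ∧ completion (Theory α β) p A ∧
      t.value = A.code := by
    intro p
    obtain ⟨B, hB, hs⟩ := d.sound (isModel_completion theory_consistent p)
    obtain rfl := Finset.mem_singleton.1 hB
    obtain ⟨A, hA, hc, h⟩ := hs
    exact ⟨A, hA, hc, h.symm⟩
  obtain ⟨A, hA, hc, h⟩ := key True
  obtain ⟨A', hA', hc', h'⟩ := key False
  obtain rfl := Form.code_injective (h.symm.trans h')
  refine ⟨A, ?_, h⟩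
  by_contra hn
  have hn' : neg A ∉ Theory α β := fun hn' =>
    (completion_of_mem theory_consistent (fun _ => mem_theory_neg_neg.1) True A).2 hn' hc
  exact (completion_true_iff (fun _ => mem_theory_neg_neg.2) hn hn').1 hc hc'

end Semantics

/-! ### Derivations of true arithmetical sentences and of the axioms of PAT -/

section Prov

open Form Term

variable {α : Ordinal.{0}} {i j : ℕ} {Γ Δ : Finset (Form L)} {A B C : Form L}

theorem co_nnfSigned (A : Form L) (b : Bool) : (A.nnfSigned b).co = A.co := by
  induction A generalizing b with
  | eq | tr => cases b <;> rfl
  | neg A ih => cases b <;> exact ih _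
  | and A B ihA ihB => cases b <;> simp only [nnfSigned, co, ihA, ihB]
  | or A B ihA ihB => cases b <;> simp only [nnfSigned, co, ihA, ihB]
  | all v A ih => cases b <;> simp only [nnfSigned, co, ih]
  | ex v A ih => cases b <;> simp only [nnfSigned, co, ih]

/-- Cut-free derivability with height below `ω * (j + 1)`. Finitary rules keep the bound, and the
`ω`-rule raises `j` by one, whatever the heights of its premises below the bound are. -/
def Prov (α : Ordinal.{0}) (j : ℕ) (Γ : Finset (Form L)) : Prop :=
  ∃ n : ℕ, Der α 0 (ω * j + n) Γ

theorem Prov.mono (h : Prov α i Γ) (hij : i ≤ j) : Prov α j Γ := by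
  obtain ⟨n, d⟩ := h
  refine ⟨n, d.mono ?_⟩
  gcongr

namespace Prov

theorem ax (hΓ : IsSequent Γ) (h : IsAxiom α 0 Γ) : Prov α j Γ :=
  ⟨0, .ax hΓ (h.mono le_rfl bot_le fun _ h _ => h)⟩

theorem omega0_mul_add_lt (i n : ℕ) {j : ℕ} (h : i < j) : ω * (i : Ordinal.{0}) + n < ω * j :=
  calc ω * (i : Ordinal.{0}) + n < ω * i + ω := by simp
    _ = ω * ((i + 1 : ℕ) : Ordinal.{0}) := by push_cast; rw [mul_add, mul_one]
    _ ≤ ω * j := by gcongr; exact h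

theorem add_lt_add_one (j n : ℕ) : ω * (j : Ordinal.{0}) + n < ω * j + (n + 1 : ℕ) := by
  simp

theorem disj {F : ℕ → Form L} (hΓ : IsSequent Γ) (hC : Disj C F) (h : C ∈ Γ) (n : ℕ)
    (d : IsSequent (insert (F n) Γ) → Prov α j (insert (F n) Γ)) : Prov α j Γ := by
  obtain ⟨m, d⟩ := d (isSequent_insert.2 ⟨hC.good (hΓ _ h) n, hΓ⟩)
  exact ⟨m + 1, .disj hC h n (add_lt_add_one j m) d⟩

theorem ex {v : ℕ} (hΓ : IsSequent Γ) (h : Form.ex v A ∈ Γ) (n : ℕ)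
    (d : IsSequent (insert (A.subst v (num n)) Γ) → Prov α j (insert (A.subst v (num n)) Γ)) :
    Prov α j Γ :=
  disj hΓ (.ex v A) h n d

theorem or (hΓ : IsSequent Γ) (h : Form.or A B ∈ Γ)
    (d : IsSequent (insert A (insert B Γ)) → Prov α j (insert A (insert B Γ))) : Prov α j Γ :=
  disj hΓ (.or A B) h 1 fun hΓ =>
    disj hΓ (.or A B) (Finset.mem_insert_of_mem h) 0 d

theorem and (hΓ : IsSequent Γ) (h : Form.and A B ∈ Γ)
    (d₀ : IsSequent (insert A Γ) → Prov α j (insert A Γ))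
    (d₁ : IsSequent (insert B Γ) → Prov α j (insert B Γ)) : Prov α j Γ := by
  have hg := (Conj.and A B).good (hΓ _ h)
  obtain ⟨m, d₀⟩ := d₀ (isSequent_insert.2 ⟨hg 0, hΓ⟩)
  obtain ⟨n, d₁⟩ := d₁ (isSequent_insert.2 ⟨hg 1, hΓ⟩)
  refine ⟨m + n + 1, .conj (.and A B) h (fun _ => _) (fun _ => add_lt_add_one j (m + n))
    fun l => ?_⟩
  by_cases e : l = 0 <;> simp only [e, if_true, if_false]
  · exact d₀.mono (by gcongr; omega)
  · exact d₁.mono (by gcongr; omega)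

theorem all {v : ℕ} (hΓ : IsSequent Γ) (h : Form.all v A ∈ Γ) (hij : i < j)
    (d : ∀ n, IsSequent (insert (A.subst v (num n)) Γ) →
      Prov α i (insert (A.subst v (num n)) Γ)) : Prov α j Γ := by
  have hg := (Conj.all v A).good (hΓ _ h)
  choose b hb using fun n => d n (isSequent_insert.2 ⟨hg n, hΓ⟩)
  refine ⟨0, .conj (.all v A) h _ (fun n => ?_) hb⟩
  simpa using omega0_mul_add_lt i (b n) hij

theorem cons (hΓ : IsSequent Γ) (n : ℕ)
    (d₀ : IsSequent (insert (tr (num n)) Γ) → Prov α j (insert (tr (num n)) Γ))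
    (d₁ : IsSequent (insert (tr (dNeg (num n))) Γ) → Prov α j (insert (tr (dNeg (num n))) Γ)) :
    Prov α j Γ := by
  obtain ⟨m, d₀⟩ := d₀ (isSequent_insert_tr (closed_num n) hΓ)
  obtain ⟨m', d₁⟩ := d₁ (isSequent_insert_tr (closed_dNeg_num n) hΓ)
  exact ⟨m + m' + 1, .cons n (add_lt_add_one j (m + m')) (d₀.mono (by gcongr; omega))
    (d₁.mono (by gcongr; omega))⟩

theorem norm (hΓ : IsSequent Γ) (n : ℕ) (hn : n ∉ sentenceCodes L)
    (d : IsSequent (insert (tr (num n)) Γ) → Prov α j (insert (tr (num n)) Γ)) : Prov α j Γ := by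
  obtain ⟨m, d⟩ := d (isSequent_insert_tr (closed_num n) hΓ)
  exact ⟨m + 1, .norm n (add_lt_add_one j m) hn d⟩

theorem and_or {A' B' : Form L} (hΓ : IsSequent Γ) (h : Form.and A B ∈ Γ)
    (h' : Form.or A' B' ∈ Γ)
    (hA : ∀ Γ, IsSequent Γ → A ∈ Γ → A' ∈ Γ → Prov α j Γ)
    (hB : ∀ Γ, IsSequent Γ → B ∈ Γ → B' ∈ Γ → Prov α j Γ) : Prov α j Γ :=
  or hΓ h' fun hΓ =>
    and hΓ (Finset.mem_insert_of_mem (Finset.mem_insert_of_mem h))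
    (fun hΓ => hA _ hΓ (by simp) (by simp)) (fun hΓ => hB _ hΓ (by simp) (by simp))

theorem all_ex {A' : Form L} {v : ℕ} (hΓ : IsSequent Γ) (h : Form.all v A ∈ Γ)
    (h' : Form.ex v A' ∈ Γ)
    (hA : ∀ n Γ, IsSequent Γ → A.subst v (num n) ∈ Γ → A'.subst v (num n) ∈ Γ → Prov α j Γ) :
    Prov α (j + 1) Γ :=
  all hΓ h j.lt_succ_self fun n hΓ => ex hΓ (Finset.mem_insert_of_mem h') n fun hΓ =>
    hA n _ hΓ (by simp) (by simp)

end Prov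

theorem all_subst (v : ℕ) (A : Form L) (x : ℕ) (s : Term L) :
    (all v A).subst x s = all v (if v = x then A else A.subst x s) := by
  by_cases h : v = x <;> simp [Form.subst, h]

theorem ex_subst (v : ℕ) (A : Form L) (x : ℕ) (s : Term L) :
    (ex v A).subst x s = ex v (if v = x then A else A.subst x s) := by
  by_cases h : v = x <;> simp [Form.subst, h]

theorem instance_subst (v : ℕ) (A : Form L) (x : ℕ) {s : Term L} (hs : s.Closed) (n : ℕ) :
    (if v = x then A else A.subst x s).subst v (num n) = (A.subst v (num n)).subst x s := by
  by_cases h : v = x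
  · subst h
    rw [if_pos rfl, Form.subst_subst_self, (closed_num n).subst_eq]
  · rw [if_neg h, Form.subst_comm (Ne.symm h) (closed_num n) (freeFor_of_closed hs _ _),
      hs.subst_eq]

theorem value_subst_congr {s t : Term L} (hs : s.Closed) (ht : t.Closed)
    (hv : s.value = t.value) (r : Term L) (x : ℕ) :
    (r.subst x s).value = (r.subst x t).value := by
  rw [value, value, val_subst, val_subst, hs.val_eq, ht.val_eq, hv]

/-- Excluded middle, for instances of a formula with terms of equal value. -/
theorem prov_congr {x : ℕ} {s t : Term L} (hs : s.Closed) (ht : t.Closed)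
    (hv : s.value = t.value) (b : Bool) (hΓ : IsSequent Γ)
    (h : (A.subst x s).nnfSigned b ∈ Γ) (h' : (A.subst x t).nnfSigned (!b) ∈ Γ) :
    Prov α A.co Γ := by
  have key : ∀ m : ℕ, ∀ A : Form L, A.size = m → ∀ b Γ, IsSequent Γ →
      (A.subst x s).nnfSigned b ∈ Γ → (A.subst x t).nnfSigned (!b) ∈ Γ → Prov α A.co Γ := by
    clear h h' hΓ
    intro m
    induction m using Nat.strong_induction_on with
    | _ m ih =>
      intro A hm b Γ hΓ h h'
      cases A with
      | eq p q =>
        have hp := value_subst_congr hs ht hv p x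
        have hq := value_subst_congr hs ht hv q x
        by_cases e : (p.subst x s).value = (q.subst x s).value
        · cases b
          · exact .ax hΓ (.eq h' (by rw [← hp, ← hq, e]))
          · exact .ax hΓ (.eq h e)
        · cases b
          · exact .ax hΓ (.ne h e)
          · exact .ax hΓ (.ne h' (by rwa [← hp, ← hq]))
      | tr p =>
        have hp := value_subst_congr hs ht hv p x
        cases b
        · exact .ax hΓ (.tr h' h hp)
        · exact .ax hΓ (.tr h h' hp.symm)
      | neg A =>
        have h1 : A.size < m := by simp only [size] at hm; omega
        cases b
        · exact ih _ h1 A rfl true Γ hΓ h h'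
        · exact ih _ h1 A rfl false Γ hΓ h h'
      | and A B =>
        have h1 : A.size < m := by simp only [size] at hm; omega
        have h2 : B.size < m := by simp only [size] at hm; omega
        have h3 : A.co ≤ (Form.and A B).co := by simp only [co]; omega
        have h4 : B.co ≤ (Form.and A B).co := by simp only [co]; omega
        cases b
        · exact .and_or hΓ h' h (fun Γ hΓ h h' => (ih _ h1 A rfl false Γ hΓ h' h).mono h3)
            fun Γ hΓ h h' => (ih _ h2 B rfl false Γ hΓ h' h).mono h4
        · exact .and_or hΓ h h' (fun Γ hΓ h h' => (ih _ h1 A rfl true Γ hΓ h h').mono h3)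
            fun Γ hΓ h h' => (ih _ h2 B rfl true Γ hΓ h h').mono h4
      | or A B =>
        have h1 : A.size < m := by simp only [size] at hm; omega
        have h2 : B.size < m := by simp only [size] at hm; omega
        have h3 : A.co ≤ (Form.and A B).co := by simp only [co]; omega
        have h4 : B.co ≤ (Form.and A B).co := by simp only [co]; omega
        cases b
        · exact .and_or hΓ h h' (fun Γ hΓ h h' => (ih _ h1 A rfl false Γ hΓ h h').mono h3)
            fun Γ hΓ h h' => (ih _ h2 B rfl false Γ hΓ h h').mono h4
        · exact .and_or hΓ h' h (fun Γ hΓ h h' => (ih _ h1 A rfl true Γ hΓ h' h).mono h3)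
            fun Γ hΓ h h' => (ih _ h2 B rfl true Γ hΓ h' h).mono h4
      | all v A =>
        have h1 : A.size < m := by simp only [size] at hm; omega
        rw [all_subst] at h h'
        have key : ∀ n Γ b, IsSequent Γ →
            ((if v = x then A else A.subst x s).nnfSigned b).subst v (num n) ∈ Γ →
            ((if v = x then A else A.subst x t).nnfSigned (!b)).subst v (num n) ∈ Γ →
            Prov α A.co Γ := by
          intro n Γ b hΓ h h'
          rw [← nnfSigned_subst, instance_subst _ _ _ ‹_›] at h h'
          have := ih _ h1 (A.subst v (num n)) (size_subst _ _ _) b Γ hΓ h h'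
          rwa [co_subst] at this
        cases b
        · exact .all_ex hΓ h' h fun n Γ hΓ h h' => key n Γ false hΓ h' h
        · exact .all_ex hΓ h h' fun n Γ hΓ h h' => key n Γ true hΓ h h'
      | ex v A =>
        have h1 : A.size < m := by simp only [size] at hm; omega
        rw [ex_subst] at h h'
        have key : ∀ n Γ b, IsSequent Γ →
            ((if v = x then A else A.subst x s).nnfSigned b).subst v (num n) ∈ Γ →
            ((if v = x then A else A.subst x t).nnfSigned (!b)).subst v (num n) ∈ Γ →
            Prov α A.co Γ := by
          intro n Γ b hΓ h h'
          rw [← nnfSigned_subst, instance_subst _ _ _ ‹_›] at h h'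
          have := ih _ h1 (A.subst v (num n)) (size_subst _ _ _) b Γ hΓ h h'
          rwa [co_subst] at this
        cases b
        · exact .all_ex hΓ h h' fun n Γ hΓ h h' => key n Γ false hΓ h h'
        · exact .all_ex hΓ h' h fun n Γ hΓ h h' => key n Γ true hΓ h' h
  exact key _ A rfl b Γ hΓ h h'

theorem prov_em (hΓ : IsSequent Γ) (hj : A.co ≤ j) (h : A.nnfSigned true ∈ Γ)
    (h' : A.nnfSigned false ∈ Γ) : Prov α j Γ := by
  have hA : A.IsSentence := by
    have := (hΓ _ h).1
    rwa [IsSentence, fv_nnfSigned] at this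
  refine (prov_congr (A := A) (x := 0) closed_zero closed_zero rfl true hΓ ?_ ?_).mono hj
  · rwa [hA.subst_eq]
  · rwa [hA.subst_eq]

/-- Derivability of true arithmetical sentences in negation normal form. -/
theorem prov_of_sat {X : Set ℕ} (hΓ : IsSequent Γ) (h : A ∈ Γ) (hA : A.Arithmetical)
    (hs : A.Sat X (fun _ => 0)) : Prov α A.co Γ := by
  have key : ∀ m : ℕ, ∀ A : Form L, A.size = m → ∀ Γ, IsSequent Γ → A ∈ Γ → A.Arithmetical →
      A.Sat X (fun _ => 0) → Prov α A.co Γ := by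
    intro m
    induction m using Nat.strong_induction_on with
    | _ m ih =>
      intro A hm Γ hΓ h hA hs
      cases A with
      | eq s t => exact .ax hΓ (.eq h hs)
      | tr t => exact hA.elim
      | neg A =>
        cases A with
        | eq s t => exact .ax hΓ (.ne h hs)
        | tr t => exact hA.elim
        | _ => exact (hΓ _ h).2.elim
      | and A B =>
        have h1 : A.size < m := by simp only [size] at hm; omega
        have h2 : B.size < m := by simp only [size] at hm; omega
        exact .and hΓ h
          (fun hΓ => (ih _ h1 A rfl _ hΓ (by simp) hA.1 hs.1).mono (by simp only [co]; omega))
          (fun hΓ => (ih _ h2 B rfl _ hΓ (by simp) hA.2 hs.2).mono (by simp only [co]; omega))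
      | or A B =>
        have h1 : A.size < m := by simp only [size] at hm; omega
        have h2 : B.size < m := by simp only [size] at hm; omega
        refine .or hΓ h fun hΓ => ?_
        rcases hs with hs | hs
        · exact (ih _ h1 A rfl _ hΓ (by simp) hA.1 hs).mono (by simp only [co]; omega)
        · exact (ih _ h2 B rfl _ hΓ (by simp) hA.2 hs).mono (by simp only [co]; omega)
      | all v A =>
        have h1 : A.size < m := by simp only [size] at hm; omega
        refine .all hΓ h (Nat.lt_succ_self A.co) fun n hΓ => ?_
        have := ih _ h1 (A.subst v (num n)) (size_subst _ _ _) _ hΓ (by simp)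
          (arithmetical_subst (A := A) hA _ _) (sat_subst_num.2 (hs n))
        rwa [co_subst] at this
      | ex v A =>
        have h1 : A.size < m := by simp only [size] at hm; omega
        obtain ⟨n, hs⟩ := hs
        refine .ex hΓ h n fun hΓ => ?_
        have := ih _ h1 (A.subst v (num n)) (size_subst _ _ _) _ hΓ (by simp)
          (arithmetical_subst (A := A) hA _ _) (sat_subst_num.2 hs)
        rw [co_subst] at this
        exact this.mono (Nat.le_succ _)
  exact key _ A rfl Γ hΓ h hA hs

/-- The progress step of induction: from `A(0)` and the progressiveness of `A`, every numerical
instance of `A` is derived by finitely many inferences. -/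
theorem prov_induction {x : ℕ} (n : ℕ) (hΓ : IsSequent Γ) (hj : A.co ≤ j)
    (h0 : (A.subst x zero).nnfSigned false ∈ Γ)
    (hS : (all x (A.imp (A.subst x (var x).succ))).nnfSigned false ∈ Γ)
    (hn : (A.subst x (num n)).nnfSigned true ∈ Γ) : Prov α j Γ := by
  induction n generalizing Γ with
  | zero => exact prov_em hΓ (by rwa [co_subst]) hn h0
  | succ n ih =>
    refine .ex hΓ hS n fun hΓ => ?_
    refine .and (A := (A.subst x (num n)).nnfSigned true)
      (B := ((A.subst x (var x).succ).subst x (num n)).nnfSigned false) hΓ ?_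
      (fun hΓ => ih hΓ (by simp [h0]) (by simp [hS]) (by simp)) fun hΓ => ?_
    · rw [nnfSigned_subst, nnfSigned_subst]
      exact Finset.mem_insert_self _ _
    · rw [Form.subst_subst_self] at hΓ ⊢
      have e : (var x).succ.subst x (num n) = (num (n + 1) : Term L) := by
        simp only [succ, Term.subst, num]
        congr 1
        funext k
        obtain rfl : k = (0 : Fin 1) := Subsingleton.elim (α := Fin 1) _ _
        simp [Term.subst]
      rw [e] at hΓ ⊢
      exact prov_em (A := A.subst x (num (n + 1))) hΓ (by rwa [co_subst]) (by simp [hn])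
        (by simp)

end Prov

section Axioms

open Form Term

variable {α : Ordinal.{0}} {i j : ℕ} {Γ Δ : Finset (Form L)} {A B C : Form L}

theorem mem_insert₁ {a b : Form L} {s : Finset (Form L)} : b ∈ insert a (insert b s) := by
  simp

theorem mem_insert₂ {a b c : Form L} {s : Finset (Form L)} :
    c ∈ insert a (insert b (insert c s)) := by
  simp

theorem prov_basicAxiom {D : Set (Form L)}
    (hD : ∀ A ∈ D, A.IsSentence ∧ A.Arithmetical ∧ A.Holds) (h : BasicAxiom D A)
    (hA : A.IsSentence) (hj : A.co ≤ j) : Prov α j {A.nnf} := by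
  have hΓ : IsSequent {A.nnf} := isSequent_singleton.2 ⟨hA.nnfSigned _, isNNF_nnfSigned _ _⟩
  cases h with
  | imp_intro A B =>
    simp only [co, Form.imp] at hj
    refine .or hΓ (Finset.mem_singleton_self _) fun hΓ => .or hΓ mem_insert₁ fun hΓ => ?_
    exact prov_em (A := A) hΓ (by omega) (by simp) (by simp [nnfSigned])
  | imp_distrib A B C =>
    simp only [co, Form.imp] at hj
    refine .or hΓ (Finset.mem_singleton_self _) fun hΓ => .or hΓ mem_insert₁ fun hΓ =>
      .or hΓ mem_insert₁ fun hΓ => .and hΓ mem_insert₂ (fun hΓ => ?_) fun hΓ =>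
      .and (A := A.nnfSigned true) (B := (B.imp C).nnfSigned false) hΓ
        (by simp [nnfSigned, Form.imp]) (fun hΓ => ?_) fun hΓ =>
      .and hΓ (Finset.mem_insert_self _ _) (fun hΓ => ?_) fun hΓ => ?_
    · exact prov_em (A := A) hΓ (by omega) (by simp [nnfSigned]) (by simp [nnfSigned])
    · exact prov_em (A := A) hΓ (by omega) (by simp [nnfSigned]) (by simp [nnfSigned])
    · exact prov_em (A := B) hΓ (by omega) (by simp [nnfSigned]) (by simp [nnfSigned])
    · exact prov_em (A := C) hΓ (by omega) (by simp [nnfSigned]) (by simp [nnfSigned])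
  | and_left A B =>
    simp only [co, Form.imp] at hj
    refine .or hΓ (Finset.mem_singleton_self _) fun hΓ =>
      .or hΓ (Finset.mem_insert_self _ _) fun hΓ => ?_
    exact prov_em (A := A) hΓ (by omega) (by simp [nnfSigned]) (by simp [nnfSigned])
  | and_right A B =>
    simp only [co, Form.imp] at hj
    refine .or hΓ (Finset.mem_singleton_self _) fun hΓ =>
      .or hΓ (Finset.mem_insert_self _ _) fun hΓ => ?_
    exact prov_em (A := B) hΓ (by omega) (by simp [nnfSigned]) (by simp [nnfSigned])
  | and_intro A B =>
    simp only [co, Form.imp] at hj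
    refine .or hΓ (Finset.mem_singleton_self _) fun hΓ => .or hΓ mem_insert₁ fun hΓ =>
      .and hΓ mem_insert₁ (fun hΓ => ?_) fun hΓ => ?_
    · exact prov_em (A := A) hΓ (by omega) (by simp [nnfSigned]) (by simp [nnfSigned])
    · exact prov_em (A := B) hΓ (by omega) (by simp [nnfSigned]) (by simp [nnfSigned])
  | or_left A B =>
    simp only [co, Form.imp] at hj
    refine .or hΓ (Finset.mem_singleton_self _) fun hΓ => .or hΓ mem_insert₁ fun hΓ => ?_
    exact prov_em (A := A) hΓ (by omega) (by simp [nnfSigned]) (by simp [nnfSigned])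
  | or_right A B =>
    simp only [co, Form.imp] at hj
    refine .or hΓ (Finset.mem_singleton_self _) fun hΓ => .or hΓ mem_insert₁ fun hΓ => ?_
    exact prov_em (A := B) hΓ (by omega) (by simp [nnfSigned]) (by simp [nnfSigned])
  | or_elim A B C =>
    simp only [co, Form.imp] at hj
    refine .or hΓ (Finset.mem_singleton_self _) fun hΓ => .or hΓ mem_insert₁ fun hΓ =>
      .or hΓ mem_insert₁ fun hΓ => .and hΓ mem_insert₂ (fun hΓ => ?_) fun hΓ => ?_
    · refine .and (A := A.nnfSigned false) (B := B.nnfSigned false) hΓ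
        (by simp [nnfSigned]) (fun hΓ => ?_) fun hΓ => ?_
      · exact .and (A := A.nnfSigned true) (B := C.nnfSigned false) hΓ
          (by simp [nnfSigned, Form.imp])
          (fun hΓ => prov_em (A := A) hΓ (by omega) (by simp) (by simp))
          fun hΓ => prov_em (A := C) hΓ (by omega) (by simp [nnfSigned]) (by simp)
      · exact prov_em (A := B) hΓ (by omega) (by simp [nnfSigned]) (by simp [nnfSigned])
    · exact prov_em (A := C) hΓ (by omega) (by simp [nnfSigned]) (by simp [nnfSigned])
  | neg_intro A B =>
    simp only [co, Form.imp] at hj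
    refine .or hΓ (Finset.mem_singleton_self _) fun hΓ => .or hΓ mem_insert₁ fun hΓ =>
      .and hΓ (Finset.mem_insert_self _ _) (fun hΓ => ?_) fun hΓ =>
      .and (A := A.nnfSigned true) (B := B.nnfSigned false) hΓ
        (by simp [nnfSigned, Form.imp]) (fun hΓ => ?_) fun hΓ => ?_
    · exact prov_em (A := A) hΓ (by omega) (by simp [nnfSigned]) (by simp [nnfSigned])
    · exact prov_em (A := A) hΓ (by omega) (by simp [nnfSigned]) (by simp [nnfSigned])
    · exact prov_em (A := B) hΓ (by omega) (by simp [nnfSigned]) (by simp [nnfSigned])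
  | neg_elim A =>
    simp only [co, Form.imp] at hj
    refine .or hΓ (Finset.mem_singleton_self _) fun hΓ => ?_
    exact prov_em (A := A) hΓ (by omega) (by simp [nnfSigned]) (by simp [nnfSigned])
  | all_elim x t A h =>
    have hs := (isSentence_or.1 hA).2
    obtain ⟨r, hr, e⟩ := exists_closed_subst_eq h hs
    rw [e] at hΓ hj ⊢
    simp only [co, Form.imp] at hj
    refine .or hΓ (Finset.mem_singleton_self _) fun hΓ =>
      .ex hΓ (Finset.mem_insert_self _ _) r.value fun hΓ => ?_
    rw [← nnfSigned_subst] at hΓ ⊢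
    exact (prov_congr (A := A) (x := x) (closed_num r.value) hr (value_num _) false hΓ
      (by simp) (by simp)).mono (by omega)
  | all_distrib x A B =>
    simp only [co, Form.imp] at hj
    refine .or hΓ (Finset.mem_singleton_self _) fun hΓ => .or hΓ mem_insert₁ fun hΓ =>
      .all (i := max A.co B.co) hΓ mem_insert₁ (by omega) fun n hΓ => ?_
    rw [← nnfSigned_subst] at hΓ ⊢
    refine .ex (A := A.nnfSigned false) (v := x) hΓ (by simp [nnfSigned]) n fun hΓ => ?_
    rw [← nnfSigned_subst] at hΓ ⊢
    refine .ex (A := (A.imp B).nnfSigned false) (v := x) hΓ (by simp [nnfSigned]) n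
      fun hΓ => ?_
    rw [← nnfSigned_subst] at hΓ ⊢
    refine .and (A := (A.subst x (num n)).nnfSigned true)
      (B := (B.subst x (num n)).nnfSigned false) hΓ (Finset.mem_insert_self _ _)
      (fun hΓ => ?_) fun hΓ => ?_
    · exact prov_em (A := A.subst x (num n)) hΓ (by rw [co_subst]; omega) (by simp) (by simp)
    · exact prov_em (A := B.subst x (num n)) hΓ (by rw [co_subst]; omega) (by simp) (by simp)
  | all_intro x A h =>
    simp only [co, Form.imp] at hj
    refine .or hΓ (Finset.mem_singleton_self _) fun hΓ =>
      .all (i := A.co) hΓ mem_insert₁ (by omega) fun n hΓ => ?_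
    rw [← nnfSigned_subst, subst_of_notMem_fv _ h] at hΓ ⊢
    exact prov_em (A := A) hΓ (by omega) (by simp) (by simp [nnfSigned])
  | ex_intro x t A h =>
    have hs : (A.subst x t).IsSentence := (isSentence_or.1 hA).1
    obtain ⟨r, hr, e⟩ := exists_closed_subst_eq h hs
    rw [e] at hΓ hj ⊢
    simp only [co, Form.imp] at hj
    refine .or hΓ (Finset.mem_singleton_self _) fun hΓ =>
      .ex hΓ mem_insert₁ r.value fun hΓ => ?_
    rw [← nnfSigned_subst] at hΓ ⊢
    exact (prov_congr (A := A) (x := x) (closed_num r.value) hr (value_num _) true hΓ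
      (by simp) (by simp [nnfSigned])).mono (by omega)
  | ex_elim x A B h =>
    simp only [co, Form.imp] at hj
    refine .or hΓ (Finset.mem_singleton_self _) fun hΓ => .or hΓ mem_insert₁ fun hΓ =>
      .all (i := max A.co B.co) hΓ (Finset.mem_insert_self _ _) (by omega) fun n hΓ => ?_
    rw [← nnfSigned_subst] at hΓ ⊢
    refine .ex (A := (A.imp B).nnfSigned false) (v := x) hΓ (by simp [nnfSigned]) n
      fun hΓ => ?_
    rw [← nnfSigned_subst] at hΓ ⊢
    have hB : B.subst x (num n) = B := subst_of_notMem_fv _ h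
    refine .and (A := (A.subst x (num n)).nnfSigned true)
      (B := (B.subst x (num n)).nnfSigned false) hΓ (Finset.mem_insert_self _ _)
      (fun hΓ => ?_) fun hΓ => ?_
    · exact prov_em (A := A.subst x (num n)) hΓ (by rw [co_subst]; omega) (by simp)
        (by simp [nnfSigned])
    · rw [hB] at hΓ ⊢
      exact prov_em (A := B) hΓ (by omega) (by simp) (by simp)
  | eq_refl t => exact .ax hΓ (.eq (Finset.mem_singleton_self _) rfl)
  | eq_subst x s t A hs ht =>
    have hst : s.Closed ∧ t.Closed := Set.union_empty_iff.1 (isSentence_or.1 hA).1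
    simp only [co, co_subst, Form.imp] at hj
    refine .or hΓ (Finset.mem_singleton_self _) fun hΓ => .or hΓ mem_insert₁ fun hΓ => ?_
    by_cases e : s.value = t.value
    · exact (prov_congr (A := A) (x := x) hst.1 hst.2 e false hΓ (by simp [nnfSigned])
        (by simp)).mono (by omega)
    · exact .ax hΓ (.ne (s := s) (t := t) (by simp [nnfSigned]) e)
  | succ_ne_zero s =>
    refine .ax hΓ (.ne (Finset.mem_singleton_self _) ?_)
    simp [value, Term.succ, Term.zero, val, FSym.interp]
  | succ_inj s t =>
    refine .or hΓ (Finset.mem_singleton_self _) fun hΓ => ?_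
    by_cases e : s.value = t.value
    · exact .ax hΓ (.eq mem_insert₁ e)
    · refine .ax hΓ (.ne (Finset.mem_insert_self _ _) ?_)
      simpa [value, Term.succ, val, FSym.interp] using e
  | add_zero s =>
    refine .ax hΓ (.eq (Finset.mem_singleton_self _) ?_)
    simp [value, Term.zero, Term.add, val, FSym.interp]
  | add_succ s t =>
    refine .ax hΓ (.eq (Finset.mem_singleton_self _) ?_)
    simp [value, Term.succ, Term.add, val, FSym.interp, Nat.add_assoc]
  | mul_zero s =>
    refine .ax hΓ (.eq (Finset.mem_singleton_self _) ?_)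
    simp [value, Term.zero, Term.mul, val, FSym.interp]
  | mul_succ s t =>
    refine .ax hΓ (.eq (Finset.mem_singleton_self _) ?_)
    simp [value, Term.succ, Term.add, Term.mul, val, FSym.interp, Nat.mul_add]
  | induction x A =>
    simp only [co, co_subst, Form.imp] at hj
    refine .or hΓ (Finset.mem_singleton_self _) fun hΓ =>
      .or hΓ (Finset.mem_insert_self _ _) fun hΓ =>
      .all (i := A.co) (A := A.nnfSigned true) (v := x) hΓ (by simp [nnfSigned]) (by omega)
        fun n hΓ => ?_
    rw [← nnfSigned_subst] at hΓ ⊢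
    exact prov_induction (x := x) n hΓ le_rfl (by simp) (by simp) (by simp)
  | defining A h =>
    have hh := hD _ h
    have := prov_of_sat (α := α) hΓ (Finset.mem_singleton_self _)
      (arithmetical_nnfSigned hh.2.1 true) ((sat_nnfSigned _).1.2 hh.2.2)
    rw [nnf, co_nnfSigned] at this
    exact this.mono hj

/-- Substitution of a closed term for `y` in an instance `A(t/x)` gives an instance of the formula
that results from `A` if the substitution is performed below a quantifier binding `x`. -/
theorem subst_closed_instance {x y : ℕ} {t q : Term L} (hq : q.Closed) (h : A.FreeFor x t) :
    (if x = y then A else A.subst y q).FreeFor x (t.subst y q) ∧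
      (A.subst x t).subst y q = (if x = y then A else A.subst y q).subst x (t.subst y q) := by
  have hv : (t.subst y q).vars ⊆ t.vars := by
    rw [vars_subst hq]
    exact Set.sdiff_subset
  by_cases e : x = y
  · subst e
    rw [if_pos rfl]
    exact ⟨h.mono hv, Form.subst_subst_self _ _ _ _⟩
  · rw [if_neg e]
    exact ⟨(h.mono hv).subst y hq, Form.subst_comm e hq h⟩

theorem notMem_fv_subst {x y : ℕ} {q : Term L} (hq : q.Closed) (h : x ∉ A.fv) :
    x ∉ (A.subst y q).fv := by
  rw [fv_subst hq]
  exact fun h' => h h'.1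

/-- Substitution of closed terms for variables turns basic axioms into basic axioms. -/
theorem BasicAxiom.subst {D : Set (Form L)} (hD : ∀ A ∈ D, A.IsSentence) (h : BasicAxiom D A)
    (y : ℕ) {q : Term L} (hq : q.Closed) : BasicAxiom D (A.subst y q) := by
  have e0 : (zero : Term L).subst y q = zero := closed_zero.subst_eq _ _
  have e1 : ∀ s : Term L, s.succ.subst y q = (s.subst y q).succ := by
    intro s
    simp only [Term.succ, Term.subst]
    congr 1
    funext k
    obtain rfl : k = (0 : Fin 1) := Subsingleton.elim (α := Fin 1) _ _
    rfl
  have e2 : ∀ s t : Term L, (s.add t).subst y q = (s.subst y q).add (t.subst y q) := by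
    intro s t
    simp only [Term.add, Term.subst]
    congr 1
    funext k
    revert k
    exact Fin.forall_fin_two.2 ⟨rfl, rfl⟩
  have e3 : ∀ s t : Term L, (s.mul t).subst y q = (s.subst y q).mul (t.subst y q) := by
    intro s t
    simp only [Term.mul, Term.subst]
    congr 1
    funext k
    revert k
    exact Fin.forall_fin_two.2 ⟨rfl, rfl⟩
  cases h with
  | imp_intro A B => exact .imp_intro _ _
  | imp_distrib A B C => exact .imp_distrib _ _ _
  | and_left A B => exact .and_left _ _
  | and_right A B => exact .and_right _ _
  | and_intro A B => exact .and_intro _ _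
  | or_left A B => exact .or_left _ _
  | or_right A B => exact .or_right _ _
  | or_elim A B C => exact .or_elim _ _ _
  | neg_intro A B => exact .neg_intro _ _
  | neg_elim A => exact .neg_elim _
  | all_elim x t A h =>
    obtain ⟨h1, h2⟩ := subst_closed_instance (y := y) hq h
    simp only [Form.imp, Form.subst.eq_5, Form.subst.eq_3, all_subst, h2]
    exact .all_elim x _ _ h1
  | all_distrib x A B =>
    simp only [Form.imp, Form.subst.eq_5, Form.subst.eq_3, all_subst]
    by_cases e : x = y
    · simp only [e, if_true]
      exact .all_distrib _ _ _
    · simp only [e, if_false]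
      exact .all_distrib _ _ _
  | all_intro x A h =>
    simp only [Form.imp, Form.subst.eq_5, Form.subst.eq_3, all_subst]
    by_cases e : x = y
    · subst e
      rw [subst_of_notMem_fv q h, if_pos rfl]
      exact .all_intro _ _ h
    · simp only [e, if_false]
      exact .all_intro _ _ (notMem_fv_subst hq h)
  | ex_intro x t A h =>
    obtain ⟨h1, h2⟩ := subst_closed_instance (y := y) hq h
    simp only [Form.imp, Form.subst.eq_5, Form.subst.eq_3, ex_subst, h2]
    exact .ex_intro x _ _ h1
  | ex_elim x A B h =>
    simp only [Form.imp, Form.subst.eq_5, Form.subst.eq_3, all_subst, ex_subst]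
    by_cases e : x = y
    · subst e
      simp only [if_true, subst_of_notMem_fv q h]
      exact .ex_elim _ _ _ h
    · simp only [e, if_false]
      exact .ex_elim _ _ _ (notMem_fv_subst hq h)
  | eq_refl t => exact .eq_refl _
  | eq_subst x s t A hs ht =>
    obtain ⟨h1, h2⟩ := subst_closed_instance (y := y) hq hs
    obtain ⟨h3, h4⟩ := subst_closed_instance (y := y) hq ht
    simp only [Form.imp, Form.subst.eq_5, Form.subst.eq_3, Form.subst.eq_1, h2, h4]
    exact .eq_subst x _ _ _ h1 h3
  | succ_ne_zero s =>
    simp only [Form.subst, e0, e1]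
    exact .succ_ne_zero _
  | succ_inj s t =>
    simp only [Form.imp, Form.subst, e1]
    exact .succ_inj _ _
  | add_zero s =>
    simp only [Form.subst, e0, e2]
    exact .add_zero _
  | add_succ s t =>
    simp only [Form.subst, e1, e2]
    exact .add_succ _ _
  | mul_zero s =>
    simp only [Form.subst, e0, e3]
    exact .mul_zero _
  | mul_succ s t =>
    simp only [Form.subst, e1, e2, e3]
    exact .mul_succ _ _
  | induction x A =>
    have hx : ((var x).succ : Term L).vars ⊆ {x} := by
      simp [Term.succ, vars, FSym.arity]
    have h2 := (subst_closed_instance (y := y) hq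
      (freeFor_of_closed (closed_zero (L := L)) A x)).2
    have h3 := (subst_closed_instance (y := y) hq (freeFor_of_vars_subset hx A)).2
    simp only [Form.imp, Form.subst.eq_5, Form.subst.eq_4, Form.subst.eq_3, all_subst, h2, e0]
    by_cases e : x = y
    · simp only [e, if_true]
      exact .induction _ _
    · rw [if_neg e, e1] at h3
      simp only [Term.subst, e, if_false] at h3
      simp only [e, if_false, h3]
      exact .induction _ _
  | defining A h =>
    rw [(hD _ h).subst_eq]
    exact .defining _ h

theorem subst_foldr_all (D : Set (Form L)) (hD : ∀ A ∈ D, A.IsSentence) (vs : List ℕ)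
    (hB : BasicAxiom D B) (y : ℕ) {q : Term L} (hq : q.Closed) :
    ∃ B', BasicAxiom D B' ∧ (vs.foldr Form.all B).subst y q = vs.foldr Form.all B' := by
  induction vs with
  | nil => exact ⟨_, hB.subst hD y hq, rfl⟩
  | cons v vs ih =>
    rw [List.foldr_cons, all_subst]
    by_cases e : v = y
    · exact ⟨B, hB, by rw [if_pos e]; rfl⟩
    · obtain ⟨B', hB', h⟩ := ih
      exact ⟨B', hB', by rw [if_neg e, h]; rfl⟩

theorem prov_axPAT {D : Set (Form L)}
    (hD : ∀ A ∈ D, A.IsSentence ∧ A.Arithmetical ∧ A.Holds) (h : AxPAT D A) :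
    Prov α A.co {A.nnf} := by
  obtain ⟨hA, vs, B, hB, rfl⟩ := h
  induction vs generalizing B with
  | nil => exact prov_basicAxiom hD hB hA le_rfl
  | cons v vs ih =>
    have hΓ : IsSequent {((v :: vs).foldr Form.all B).nnf} :=
      isSequent_singleton.2 ⟨hA.nnfSigned _, isNNF_nnfSigned _ _⟩
    refine .all hΓ (Finset.mem_singleton_self _) (Nat.lt_succ_self _) fun n hΓ => ?_
    rw [← nnfSigned_subst] at hΓ ⊢
    obtain ⟨B', hB', e⟩ :=
      subst_foldr_all D (fun A hA => (hD A hA).1) vs hB v (closed_num (L := L) n)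
    have hs : ((vs.foldr Form.all B).subst v (num n)).IsSentence :=
      (isSentence_all_iff (closed_num n)).1 hA
    have hc := co_subst (vs.foldr Form.all B) v (num n)
    rw [e] at hs hc hΓ ⊢
    obtain ⟨m, d⟩ := ih B' hB' hs
    rw [← hc]
    exact ⟨m, d.weaken le_rfl le_rfl le_rfl (by simp [nnf]) hΓ⟩

end Axioms

/-! ### Ordinal arithmetic below epsilon numbers -/

section Epsilon

variable {a b δ : Ordinal.{0}}

theorem add_lt_epsilon (ha : a < Ordinal.epsilon δ) (hb : b < Ordinal.epsilon δ) :
    a + b < Ordinal.epsilon δ := by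
  rw [← Ordinal.omega0_opow_epsilon δ] at *
  exact Ordinal.isPrincipal_add_omega0_opow _ ha hb

theorem two_mul_lt_epsilon (ha : a < Ordinal.epsilon δ) : 2 * a < Ordinal.epsilon δ := by
  have h1 : (1 : Ordinal.{0}) < Ordinal.epsilon δ := by simpa using Ordinal.natCast_lt_epsilon 1 δ
  have h2 : (2 : Ordinal.{0}) ≤ ω := by simpa using (Ordinal.natCast_lt_omega0 2).le
  calc 2 * a ≤ ω * ω ^ a := mul_le_mul' h2 omega0_opow_strictMono.le_apply
    _ = ω ^ (1 + a) := by rw [Ordinal.opow_add, Ordinal.opow_one]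
    _ < Ordinal.epsilon δ := opow_lt_epsilon (add_lt_epsilon h1 ha)

theorem omega0_mul_natCast_add_lt_epsilon (j n : ℕ) (δ : Ordinal.{0}) :
    ω * (j : Ordinal.{0}) + n < Ordinal.epsilon δ := by
  have h1 := Ordinal.omega0_lt_epsilon δ
  have h2 : (2 : Ordinal.{0}) < Ordinal.epsilon δ := by simpa using Ordinal.natCast_lt_epsilon 2 δ
  refine add_lt_epsilon ?_ (Ordinal.natCast_lt_epsilon n δ)
  calc ω * (j : Ordinal.{0}) ≤ ω * ω := by gcongr; exact (Ordinal.natCast_lt_omega0 j).le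
    _ = ω ^ (1 + 1 : Ordinal.{0}) := by rw [Ordinal.opow_add, Ordinal.opow_one]
    _ < Ordinal.epsilon δ := opow_lt_epsilon (by rwa [one_add_one_eq_two])

theorem epsilon_lt_epsilon (h : a < b) : Ordinal.epsilon a < Ordinal.epsilon b :=
  Ordinal.veblen_right_strictMono 1 h

end Epsilon

/-! ### Values of the terms for syntactic operations -/

section Values

open Form Term

theorem value_dEq (n m : ℕ) : (dEq (num n) (num m) : Term L).value = mkEq n m := by
  have h := fun n => Term.value_num (L := L) n
  simp only [value] at h
  simp [value, dEq, val, FSym.interp, h]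

theorem value_dAll (n m : ℕ) : (dAll (num n) (num m) : Term L).value = mkAll n m := by
  have h := fun n => Term.value_num (L := L) n
  simp only [value] at h
  simp [value, dAll, val, FSym.interp, h]

theorem value_dImp (n m : ℕ) : (dImp (num n) (num m) : Term L).value = mkOr (mkNeg n) m := by
  have h := fun n => Term.value_num (L := L) n
  simp only [value] at h
  simp [value, dImp, dOr, dNeg, val, FSym.interp, h]

theorem value_dSub (n m i : ℕ) : (dSub (num n) (num m) i : Term L).value =
    subCode L n (num i : Term L).code m := by
  have h := fun n => Term.value_num (L := L) n
  simp only [value] at h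
  simp [value, dSub, val, FSym.interp, h]

theorem subCode_code (A : Form L) (s : Term L) (v : ℕ) :
    subCode L A.code s.code (var v : Term L).code = (A.subst v s).code := by
  have h : ∃ p : Form L × Term L × ℕ, p.1.code = A.code ∧ p.2.1.code = s.code ∧
    (Term.var p.2.2 : Term L).code = (var v : Term L).code := ⟨(A, s, v), rfl, rfl, rfl⟩
  rw [subCode, dif_pos h]
  obtain ⟨h1, h2, h3⟩ := h.choose_spec
  rw [Form.code_injective h1, Term.code_injective h2, Term.var.inj (Term.code_injective h3)]

theorem Form.code_ne_zero (A : Form L) : A.code ≠ 0 := by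
  cases A <;> simp [Form.code, mkEq, mkTr, mkNeg, mkAnd, mkOr, mkAll, mkEx]

theorem exists_of_subCode_eq {a s v : ℕ} {B : Form L} (h : subCode L a s v = B.code) :
    ∃ (A : Form L) (w : ℕ), A.code = a ∧ (var w : Term L).code = v := by
  by_cases hp : ∃ p : Form L × Term L × ℕ, p.1.code = a ∧ p.2.1.code = s ∧
    (Term.var p.2.2 : Term L).code = v
  · obtain ⟨p, h1, -, h3⟩ := hp
    exact ⟨p.1, p.2.2, h1, h3⟩
  · rw [subCode, dif_neg hp] at h
    exact absurd h.symm B.code_ne_zero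

theorem value_quoteTr (n : ℕ) : (quoteTr n : Term L).value = (tr (num n) : Form L).code := by
  rw [quoteTr, value_dSub, subCode_code]
  simp [Form.subst, Term.subst]

theorem exists_of_code_eq_mkOr {a b : ℕ} {C : Form L} (h : C.code = mkOr a b) :
    ∃ A B : Form L, C = or A B ∧ A.code = a ∧ B.code = b := by
  cases C <;> simp [Form.code, mkEq, mkTr, mkNeg, mkAnd, mkOr, mkAll, mkEx] at h
  exact ⟨_, _, rfl, h⟩

end Values

/-! ### Soundness of VFM^∞ -/

section Soundness

open Form Term

variable {α β : Ordinal.{0}} {i j k : ℕ} {Γ Δ : Finset (Form L)} {A B C : Form L}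

theorem I.epsilon_mono (h : I 1 α (Ordinal.epsilon α) Γ) (hα : α ≤ β) :
    I 1 β (Ordinal.epsilon β) Γ := by
  rcases hα.eq_or_lt with rfl | hα
  · exact h
  · exact (h.der.weaken hα.le le_rfl le_rfl subset_rfl h.isSequent).I_epsilon
      (two_mul_lt_epsilon (epsilon_lt_epsilon hα))

theorem Satisfied.mono (h : Satisfied α A) (hα : α ≤ β) : Satisfied β A := by
  induction h with
  | eq h => exact .eq h
  | ne h => exact .ne h
  | tr A hA ht h => exact .tr A hA ht (h.epsilon_mono hα)
  | and _ _ ih ih' => exact .and ih ih'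
  | or_left _ ih => exact .or_left ih
  | or_right _ ih => exact .or_right ih
  | all _ ih => exact .all ih
  | ex n _ ih => exact .ex n ih

theorem Satisfied.sat {X : Set ℕ} (h : Satisfied α A) (hA : A.Arithmetical) :
    A.Sat X (fun _ => 0) := by
  induction h with
  | eq h => exact h
  | ne h => exact h
  | tr => exact hA.elim
  | and _ _ ih ih' => exact ⟨ih hA.1, ih' hA.2⟩
  | or_left _ ih => exact Or.inl (ih hA.1)
  | or_right _ ih => exact Or.inr (ih hA.2)
  | @all v A _ ih => exact fun n => sat_subst_num.1 (ih n (arithmetical_subst (A := A) hA _ _))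
  | @ex v A n _ ih => exact ⟨n, sat_subst_num.1 (ih (arithmetical_subst (A := A) hA _ _))⟩

theorem Satisfied.holds (hA : A.Arithmetical) (h : Satisfied α (A.nnfSigned true)) : A.Holds :=
  (sat_nnfSigned _).1.1 (h.sat (arithmetical_nnfSigned hA _))

theorem Satisfied.not_holds (hA : A.Arithmetical) (h : Satisfied α (A.nnfSigned false)) :
    ¬ A.Holds :=
  (sat_nnfSigned _).2.1 (h.sat (arithmetical_nnfSigned hA _))

theorem Satisfied.of_I {t : Term L} (ht : t.value = A.code)
    (d : I 1 α (Ordinal.epsilon α) {A.nnf}) : Satisfied α (.tr t) := by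
  have := (isSequent_singleton.1 d.isSequent).1
  rw [nnf, IsSentence, fv_nnfSigned] at this
  exact .tr A this ht d

theorem Satisfied.of_prov {t : Term L} (ht : t.value = A.code) (d : Prov α j {A.nnf}) :
    Satisfied α (.tr t) := by
  obtain ⟨n, d⟩ := d
  exact .of_I ht (d.I_epsilon (omega0_mul_natCast_add_lt_epsilon j n α))

/-- Closure under modus ponens, by a cut on the implication. -/
theorem I.modus_ponens {α₀ α₁ : Ordinal.{0}} (h₀ : α₀ < α) (h₁ : α₁ < α)
    (d₀ : I 1 α₀ (Ordinal.epsilon α₀) {A.nnf}) (d₁ : I 1 α₁ (Ordinal.epsilon α₁) {(A.imp B).nnf}) :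
    I 1 α (Ordinal.epsilon α) {B.nnf} := by
  have hAB : (A.imp B).IsSentence := by
    have := (isSequent_singleton.1 d₁.isSequent).1
    rwa [nnf, IsSentence, fv_nnfSigned] at this
  obtain ⟨hA, hB⟩ := isSentence_imp.1 hAB
  have seq : ∀ {A : Form L} {b Γ}, A.IsSentence → IsSequent Γ →
      IsSequent (insert (A.nnfSigned b) Γ) := fun hA hΓ =>
    isSequent_insert.2 ⟨⟨hA.nnfSigned _, isNNF_nnfSigned _ _⟩, hΓ⟩
  have hs : IsSequent {B.nnf} := isSequent_singleton.2 ⟨hB.nnfSigned _, isNNF_nnfSigned _ _⟩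
  have hs' : IsSequent (insert ((A.imp B).nnfSigned false) {B.nnf}) := seq hAB hs
  obtain ⟨n, e⟩ := prov_em (α := α) (A := B) (seq hB hs') le_rfl
    (Γ := insert (B.nnfSigned false) (insert ((A.imp B).nnfSigned false) {B.nnf}))
    (by simp [nnf]) (by simp)
  have hlt := fun {γ : Ordinal.{0}} (h : γ < α) => two_mul_lt_epsilon (epsilon_lt_epsilon h)
  set μ := max (2 * Ordinal.epsilon α₀) (max (2 * Ordinal.epsilon α₁) (ω * B.co + n)) with hμ
  have hμlt : μ < Ordinal.epsilon α :=
    max_lt (hlt h₀) (max_lt (hlt h₁) (omega0_mul_natCast_add_lt_epsilon _ n α))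
  have h1 : (1 : Ordinal.{0}) < Ordinal.epsilon α := by
    simpa using Ordinal.natCast_lt_epsilon 1 α
  have c₁ : Der α ((A.imp B).co + 1) μ (insert ((A.imp B).nnfSigned true) {B.nnf}) :=
    d₁.der.weaken h₁.le (Nat.zero_le _) ((le_max_left _ _).trans (le_max_right _ _))
      (by simp [nnf]) (seq hAB hs)
  have c₀ : Der α ((A.imp B).co + 1) (μ + 1) (insert ((A.imp B).nnfSigned false) {B.nnf}) := by
    refine .conj (.and (A.nnfSigned true) (B.nnfSigned false)) (Finset.mem_insert_self _ _)
      (fun _ => μ) (fun _ => lt_add_of_pos_right _ zero_lt_one) fun l => ?_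
    by_cases h : l = 0 <;> simp only [h, if_true, if_false]
    · exact d₀.der.weaken h₀.le (Nat.zero_le _) (le_max_left _ _) (by simp [nnf]) (seq hA hs')
    · exact e.weaken le_rfl (Nat.zero_le _) ((le_max_right _ _).trans (le_max_right _ _))
        subset_rfl e.isSequent
  exact (Der.cut (A.imp B) hAB (Nat.lt_succ_self _)
    (show μ < μ + 1 + 1 from (lt_add_of_pos_right _ zero_lt_one).trans
      (lt_add_of_pos_right _ zero_lt_one))
    (lt_add_of_pos_right _ zero_lt_one) c₁ c₀).I_epsilon
    (add_lt_epsilon (add_lt_epsilon hμlt h1) h1)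

theorem I_not_contradictory (d : I 1 α β {A.nnf}) (d' : I 1 α β {(neg A).nnf}) : False := by
  have hA : A.IsSentence := by
    have := (isSequent_singleton.1 d.isSequent).1
    rwa [nnf, IsSentence, fv_nnfSigned] at this
  have h : ∀ γ : Ordinal.{0}, γ < γ + 1 := fun γ => lt_add_of_pos_right _ zero_lt_one
  exact theory_consistent (α := α + 1) (β := β + 1) A ⟨hA, α, h α, β, h β, d⟩
    ⟨hA, α, h α, β, h β, d'⟩

theorem value_eq_of_I_eq {s t : Term L} (d : I 1 α β {eq s t}) : s.value = t.value := by
  obtain ⟨X, hX⟩ := exists_isModel L α (2 * β)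
  obtain ⟨B, hB, hs⟩ := d.der.sound hX
  obtain rfl := Finset.mem_singleton.1 hB
  exact hs

theorem isSentence_at1 {A : Form L} (h : A.fv ⊆ {0}) (n : ℕ) : (A.at1 n).IsSentence :=
  (isSentence_subst_iff (closed_num n)).2 (Set.sdiff_eq_empty.2 h)

theorem code_neg (A : Form L) : (neg A).code = mkNeg A.code := rfl

/-- A number cannot be both true and false: `¬ (Tr(n) ∧ Tr(¬n))`. -/
theorem prov_tr_cons (n : ℕ) :
    Prov α 0 {(neg ((tr (num n)).and (tr (dNeg (num n)))) : Form L).nnf} := by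
  have hn : (tr (num n) : Form L).IsSentence := closed_num n
  have hn' : (tr (dNeg (num n)) : Form L).IsSentence := closed_dNeg_num n
  have hΓ : IsSequent {(neg ((tr (num n)).and (tr (dNeg (num n)))) : Form L).nnf} :=
    isSequent_singleton.2 ⟨IsSentence.nnfSigned (isSentence_and.2 ⟨hn, hn'⟩) _,
      isNNF_nnfSigned _ _⟩
  refine .or hΓ (Finset.mem_singleton_self _) fun hΓ => .cons hΓ n (fun hΓ => ?_) fun hΓ => ?_
  · exact .ax hΓ (.tr (Finset.mem_insert_self _ _) mem_insert₁ rfl)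
  · exact .ax hΓ (.tr (Finset.mem_insert_self _ _) mem_insert₂ rfl)

theorem prov_tr_comp (R : Arithmetization L) (n : ℕ) :
    Prov α (R.sent.at1 n).co
      {((R.sent.at1 n).imp ((tr (num n)).or (tr (dNeg (num n))))).nnf} := by
  have hn : (tr (num n) : Form L).IsSentence := closed_num n
  have hn' : (tr (dNeg (num n)) : Form L).IsSentence := closed_dNeg_num n
  have hΓ : IsSequent {((R.sent.at1 n).imp ((tr (num n)).or (tr (dNeg (num n))))).nnf} :=
    isSequent_singleton.2 ⟨IsSentence.nnfSigned
      (isSentence_imp.2 ⟨isSentence_at1 R.sent_spec.fv n, isSentence_or.2 ⟨hn, hn'⟩⟩) _,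
      isNNF_nnfSigned _ _⟩
  refine .or hΓ (Finset.mem_singleton_self _) fun hΓ => ?_
  by_cases h : n ∈ sentenceCodes L
  · obtain ⟨A, hA, rfl⟩ := h
    refine .or hΓ mem_insert₁ fun hΓ => .ax hΓ (.comp A hA (Finset.mem_insert_self _ _)
      mem_insert₁ (value_num _) ?_)
    rw [value_dNeg_num, code_neg]
  · have ha := arithmetical_subst R.sent_spec.arithmetical 0 (num n)
    have := prov_of_sat (α := α) (A := (R.sent.at1 n).nnfSigned false) hΓ
      (Finset.mem_insert_self _ _) (arithmetical_nnfSigned ha _)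
      ((sat_nnfSigned _).2.2 (mt (R.sent_spec.spec n).1 h))
    rwa [co_nnfSigned] at this

theorem prov_tr_norm (R : Arithmetization L) (n : ℕ) :
    Prov α (R.sent.at1 n).co {((tr (num n)).imp (R.sent.at1 n)).nnf} := by
  have hn : (tr (num n) : Form L).IsSentence := closed_num n
  have hΓ : IsSequent {((tr (num n)).imp (R.sent.at1 n)).nnf} :=
    isSequent_singleton.2 ⟨IsSentence.nnfSigned
      (isSentence_imp.2 ⟨hn, isSentence_at1 R.sent_spec.fv n⟩) _, isNNF_nnfSigned _ _⟩
  refine .or hΓ (Finset.mem_singleton_self _) fun hΓ => ?_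
  by_cases h : n ∈ sentenceCodes L
  · have ha := arithmetical_subst R.sent_spec.arithmetical 0 (num n)
    have := prov_of_sat (α := α) (A := (R.sent.at1 n).nnfSigned true) hΓ
      mem_insert₁ (arithmetical_nnfSigned ha _)
      ((sat_nnfSigned _).1.2 ((R.sent_spec.spec n).2 h))
    rwa [co_nnfSigned] at this
  · exact .norm hΓ n h fun hΓ => .ax hΓ (.tr (Finset.mem_insert_self _ _) mem_insert₁ rfl)

theorem SequentSatisfied.insert_of (h : ¬ SequentSatisfied α Γ → Satisfied α A) :
    SequentSatisfied α (insert A Γ) := by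
  by_cases hΓ : SequentSatisfied α Γ
  · obtain ⟨B, hB, hs⟩ := hΓ
    exact ⟨B, Finset.mem_insert_of_mem hB, hs⟩
  · exact ⟨A, Finset.mem_insert_self _ _, h hΓ⟩

theorem SequentSatisfied.head {α₀ : Ordinal.{0}} (h : SequentSatisfied α₀ (insert A Γ))
    (hα : α₀ < α) (hΓ : ¬ SequentSatisfied α Γ) : Satisfied α₀ A := by
  obtain ⟨B, hB, hs⟩ := h
  rcases Finset.mem_insert.1 hB with rfl | hB
  · exact hs
  · exact (hΓ ⟨B, hB, hs.mono hα.le⟩).elim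

theorem Derivable.sequentSatisfied {R : Arithmetization L} (d : Derivable R 0 α Γ)
    (hpos : ∀ A ∈ Γ, A.TrPositive) : SequentSatisfied α Γ := by
  have hins : ∀ {A : Form L} {Γ : Finset (Form L)}, A.TrPositive → (∀ B ∈ Γ, B.TrPositive) →
      ∀ B ∈ insert A Γ, B.TrPositive := fun h h' => (Finset.forall_mem_insert _ _ _).2 ⟨h, h'⟩
  have htr : ∀ {t : Term L} {Γ : Finset (Form L)}, (∀ B ∈ Γ, B.TrPositive) →
      ∀ B ∈ insert (tr t) Γ, B.TrPositive := fun h => hins trivial h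
  have hct : ∀ n, (R.ct.at1 n).Arithmetical := fun n =>
    arithmetical_subst R.ct_spec.arithmetical _ _
  have hev : ∀ n m, (R.eqVal.at2 n m).Arithmetical := fun n m =>
    arithmetical_subst (arithmetical_subst R.eqVal_arithmetical _ _) _ _
  induction d with
  | @ax1 α Γ A hΓ hA =>
    refine ⟨A, Finset.mem_insert_self _ _, ?_⟩
    rcases hA with ⟨s, t, rfl, -, -, h⟩ | ⟨s, t, rfl, -, -, h⟩
    exacts [.eq h, .ne h]
  | @ax2 α Γ s t hΓ hst => exact (hpos (neg (tr s)) (Finset.mem_insert_self _ _)).elim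
  | @or α α₀ Γ A B h₀ d ih =>
    obtain ⟨hp, hp'⟩ := (Finset.forall_mem_insert _ _ _).1 hpos
    refine .insert_of fun hn => ?_
    obtain ⟨C, hC, hs⟩ := ih (hins hp.1 (hins hp.2 hp'))
    simp only [Finset.mem_insert] at hC
    rcases hC with rfl | rfl | hC
    · exact .or_left (hs.mono h₀.le)
    · exact .or_right (hs.mono h₀.le)
    · exact (hn ⟨C, hC, hs.mono h₀.le⟩).elim
  | and h₀ h₁ d₀ d₁ ih₀ ih₁ =>
    obtain ⟨hp, hp'⟩ := (Finset.forall_mem_insert _ _ _).1 hpos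
    refine .insert_of fun hn => .and ?_ ?_
    · exact ((ih₀ (hins hp.1 hp')).head h₀ hn).mono h₀.le
    · exact ((ih₁ (hins hp.2 hp')).head h₁ hn).mono h₁.le
  | @ex α α₀ Γ v A i h₀ d ih =>
    obtain ⟨hp, hp'⟩ := (Finset.forall_mem_insert _ _ _).1 hpos
    exact .insert_of fun hn =>
      .ex i (((ih (hins (trPositive_subst (A := A) hp) hp')).head h₀ hn).mono h₀.le)
  | @all α Γ v A a ha d ih =>
    obtain ⟨hp, hp'⟩ := (Finset.forall_mem_insert _ _ _).1 hpos
    exact .insert_of fun hn => .all fun i =>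
      (((ih i (hins (trPositive_subst (A := A) hp) hp')).head (ha i) hn).mono (ha i).le)
  | cut h₀ h₁ hA => exact absurd hA (Nat.not_lt_zero _)
  | tr_eq n m h₀ ht htv d ih =>
    have hp' := ((Finset.forall_mem_insert _ _ _).1 hpos).2
    have ha : (((R.ct.at1 n).and (R.ct.at1 m)).and (R.eqVal.at2 n m)).Arithmetical :=
      ⟨⟨hct n, hct m⟩, hev n m⟩
    refine .insert_of fun hn => ?_
    obtain ⟨⟨h1, h2⟩, h3⟩ :=
      ((ih (hins (trPositive_nnfSigned ha _) hp')).head h₀ hn).holds ha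
    obtain ⟨s, hs, rfl⟩ := (R.ct_spec.spec n).1 h1
    obtain ⟨t, ht, rfl⟩ := (R.ct_spec.spec m).1 h2
    rw [value_dEq] at htv
    have hsent : IsSequent {(eq s t : Form L).nnf} :=
      isSequent_singleton.2 ⟨Set.union_empty_iff.2 ⟨hs, ht⟩, trivial⟩
    exact .of_prov (A := eq s t) (j := 0) htv (.ax hsent
      (.eq (Finset.mem_singleton_self _) ((R.eqVal_spec s t hs ht).1 h3)))
  | @tr_ne α α₀ Γ n m h₀ d ih =>
    by_contra hn
    have h := (ih (hins ⟨⟨⟨trPositive_nnfSigned (hct n) _, trPositive_nnfSigned (hct m) _⟩,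
      trivial⟩, trPositive_nnfSigned (hev n m) _⟩ hpos)).head h₀ hn
    change Satisfied α₀ (Form.and (Form.and (Form.and ((R.ct.at1 n).nnfSigned true)
      ((R.ct.at1 m).nnfSigned true)) (tr (dEq (num n) (num m))))
      ((R.eqVal.at2 n m).nnfSigned false)) at h
    obtain _ | _ | _ | ⟨h, h3⟩ := h
    obtain _ | _ | _ | ⟨h, h4⟩ := h
    obtain _ | _ | _ | ⟨h1, h2⟩ := h
    obtain ⟨s, hs, rfl⟩ := (R.ct_spec.spec n).1 (h1.holds (hct n))
    obtain ⟨t, ht, rfl⟩ := (R.ct_spec.spec m).1 (h2.holds (hct m))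
    cases h4 with
    | tr A hA hv d =>
      rw [value_dEq] at hv
      obtain rfl : eq s t = A := Form.code_injective hv
      exact h3.not_holds (hev _ _) ((R.eqVal_spec s t hs ht).2 (value_eq_of_I_eq d))
  | tr_imp n m h₀ h₁ ht htv d₀ d₁ ih₀ ih₁ =>
    have hp' := ((Finset.forall_mem_insert _ _ _).1 hpos).2
    refine .insert_of fun hn => ?_
    cases (ih₀ (htr hp')).head h₀ hn with
    | tr A hA hv d =>
      cases (ih₁ (htr hp')).head h₁ hn with
      | tr C hC hv' d' =>
        rw [value_num] at hv
        subst hv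
        rw [value_dImp] at hv'
        obtain ⟨A', B, rfl, hA', rfl⟩ := exists_of_code_eq_mkOr hv'.symm
        obtain rfl : A' = neg A := Form.code_injective hA'
        exact .of_I htv (I.modus_ponens h₀ h₁ d d')
  | @tr_all α Γ n m t a ha ht htv d ih =>
    have hp' := ((Finset.forall_mem_insert _ _ _).1 hpos).2
    refine .insert_of fun hn => ?_
    have key : ∀ i, ∃ A : Form L, subCode L n (num i : Term L).code m = A.code ∧
        I 1 (a i) (Ordinal.epsilon (a i)) {A.nnf} := by
      intro i
      cases (ih i (htr hp')).head (ha i) hn with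
      | tr A hA hv d =>
        rw [value_dSub] at hv
        exact ⟨A, hv, d⟩
    obtain ⟨_, h0, -⟩ := key 0
    obtain ⟨A, v, rfl, rfl⟩ := exists_of_subCode_eq h0
    rw [value_dAll] at htv
    have key' : ∀ i, I 1 (a i) (Ordinal.epsilon (a i)) {(A.subst v (num i)).nnf} := by
      intro i
      obtain ⟨B, hB, d⟩ := key i
      rw [subCode_code] at hB
      rwa [Form.code_injective hB]
    have hsent : (Form.all v A).IsSentence := by
      have := (isSequent_singleton.1 (key' 0).isSequent).1
      rw [nnf, IsSentence, fv_nnfSigned] at this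
      exact (isSentence_all_iff (closed_num 0)).2 this
    have hΓ : IsSequent {(Form.all v A).nnf} :=
      isSequent_singleton.2 ⟨hsent.nnfSigned _, isNNF_nnfSigned _ _⟩
    -- The supremum of the heights of the premises may be `ε_ α` itself if `α` is a limit, so this
    -- derivation has to be cut-free from the start.
    have hd : Der α 0 (Ordinal.epsilon α) {(Form.all v A).nnf} := by
      refine .conj (.all v (A.nnfSigned true)) (Finset.mem_singleton_self _)
        (fun i => 2 * Ordinal.epsilon (a i))
        (fun i => two_mul_lt_epsilon (epsilon_lt_epsilon (ha i))) fun i => ?_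
      rw [← nnfSigned_subst]
      exact (key' i).der.weaken (ha i).le le_rfl le_rfl (by simp [nnf])
        (isSequent_insert.2 ⟨isSequent_singleton.1 (key' i).isSequent, hΓ⟩)
    exact .of_I (A := Form.all v A) htv (hd.to_I le_rfl subset_rfl hΓ)
  | @rep α α₀ Γ n t h₀ ht htv d ih =>
    have hp' := ((Finset.forall_mem_insert _ _ _).1 hpos).2
    refine .insert_of fun hn => ?_
    rw [value_quoteTr] at htv
    cases (ih (htr hp')).head h₀ hn with
    | tr A hA hv d =>
      have hd : Der α 0 (Ordinal.epsilon α₀ + 1) {(tr (num n) : Form L).nnf} :=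
        .ax (isSequent_singleton.2 ⟨closed_num n, trivial⟩)
          (.prov A (Finset.mem_singleton_self _)
            ⟨hA, α₀, h₀, _, lt_add_of_pos_right _ zero_lt_one, d⟩ hv)
      exact .of_I htv (hd.I_epsilon (add_lt_epsilon (epsilon_lt_epsilon h₀)
        (by simpa using Ordinal.natCast_lt_epsilon 1 α)))
  | @del α α₀ Γ n t h₀ ht htv d ih =>
    have hp' := ((Finset.forall_mem_insert _ _ _).1 hpos).2
    refine .insert_of fun hn => ?_
    cases (ih (htr hp')).head h₀ hn with
    | tr A hA hv d =>
      rw [value_quoteTr] at hv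
      obtain rfl : tr (num n) = A := Form.code_injective hv
      -- Inversion of truth, for the sentence `Tr(n)` at level `α₀`.
      obtain ⟨A, ⟨hA, α₁, h₁, β₁, hβ, d'⟩, hv⟩ := Der.exists_mem_theory d.der
      rw [value_num] at hv
      have hlt := hβ.trans (two_mul_lt_epsilon (epsilon_lt_epsilon h₀))
      exact .of_I (htv.trans hv) ((d'.der.weaken (h₁.trans h₀).le le_rfl le_rfl subset_rfl
        d'.isSequent).I_epsilon (two_mul_lt_epsilon hlt))
  | tr_cons n hΓ htv =>
    exact ⟨_, Finset.mem_insert_self _ _, .of_prov htv (prov_tr_cons n)⟩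
  | tr_comp n hΓ htv =>
    exact ⟨_, Finset.mem_insert_self _ _, .of_prov htv (prov_tr_comp R n)⟩
  | tr_norm n hΓ htv =>
    exact ⟨_, Finset.mem_insert_self _ _, .of_prov htv (prov_tr_norm R n)⟩
  | tr_pat n h₀ ht htv d ih =>
    have hp' := ((Finset.forall_mem_insert _ _ _).1 hpos).2
    have ha : (R.axPAT.at1 n).Arithmetical :=
      arithmetical_subst R.axPAT_spec.arithmetical _ _
    refine .insert_of fun hn => ?_
    have h := ((ih (hins (trPositive_nnfSigned ha _) hp')).head h₀ hn).holds ha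
    obtain ⟨A, hA, rfl⟩ := (R.axPAT_spec.spec n).1 h
    exact .of_prov htv (prov_axPAT R.defAx_spec hA)
  | @cons α α₀ Γ n h₀ d₀ d₁ ih₀ ih₁ =>
    by_contra hn
    cases (ih₀ (htr hpos)).head h₀ hn with
    | tr A hA hv d =>
      cases (ih₁ (htr hpos)).head h₀ hn with
      | tr C hC hv' d' =>
        rw [value_num] at hv
        subst hv
        rw [value_dNeg_num] at hv'
        obtain rfl : neg A = C := Form.code_injective hv'
        exact I_not_contradictory d d'

end Soundness

end VFM

theorem mainTheorem7 (L : VFM.Signature) (R : VFM.Arithmetization L) (α : Ordinal.{0})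
    (Γ : Finset (VFM.Form L)) (hΓ : VFM.IsSequent Γ) (hpos : ∀ A ∈ Γ, A.TrPositive)
    (h : VFM.Derivable R 0 α Γ) : VFM.SequentSatisfied α Γ := by
  exact h.sequentSatisfied hpos
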